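/- Conventions. For partial operations, $x\simeq y$ (Kleene equality) means that both sides are undefined or both are defined and equal; $x\preceq y$ means that if $x$ is defined, then so is $y$ and they are equal; $x\!\downarrow$ means that $x$ is defined. A *partial trace* on a strict symmetric monoidal category $(\mathcal C,\otimes,I,\sigma)$ is a family of partial functions $\mathrm{Tr}^U_{A,B}:\mathcal C(A\otimes U,B\otimes U)\rightharpoonup\mathcal C(A,B)$ with: (naturality) $h\circ\mathrm{Tr}^U(f)\circ g\preceq\mathrm{Tr}^U((h\otimes 1_U)\circ f\circ(g\otimes 1_U))$; (dinaturality) $\mathrm{Tr}^U((1_B\otimes g)\circ f)\simeq\mathrm{Tr}^{U'}(f\circ(1_A\otimes g))$ for $f:A\otimes U\to B\otimes U'$, $g:U'\to U$; (strength) $g\otimes\mathrm{Tr}^U(f)\preceq\mathrm{Tr}^U(g\otimes f)$; (vanishing) $\mathrm{Tr}^I(f)\simeq f$, and if $\mathrm{Tr}^V(f)\!\downarrow$ then $\mathrm{Tr}^U(\mathrm{Tr}^V(f))\simeq\mathrm{Tr}^{U\otimes V}(f)$; (yanking) $\mathrm{Tr}^A(\sigma_{A,A})\simeq 1_A$. A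 *paracategory* is a directed graph with a partial operation $[-]$ sending paths $A\to B$ to arrows $A\to B$, such that $[\epsilon_A]\!\downarrow$ for the empty path $\epsilon_A$ (write $1_A=[\epsilon_A]$), $[f]\simeq f$ for paths of length one, and $[\vec r,[\vec f],\vec s]\simeq[\vec r,\vec f,\vec s]$ whenever $[\vec f]\!\downarrow$. A *functor* of paracategories is a graph homomorphism $F$ with $F[\vec p]\preceq[F\vec p]$ for all paths $\vec p$. A category is a paracategory with $[f_1,\dots,f_n]=f_n\circ\dots\circ f_1$. The product of paracategories has componentwise (partial) composition. A *strict symmetric monoidal paracategory* is a paracategory with a functor $\otimes$ of two variables and an object $I$, strictly associative and unital on objects and arrows, and arrows $\sigma_{A,B}:A\otimes B\to B\otimes A$ such that $[1_X\otimes\sigma_{A,B},f]\!\downarrow$ and $[g,1_X\otimes\sigma_{A,B}]\!\downarrow$ for all composable $f,g$; $[f\otimes 1_B,\sigma]=[\sigma,1_B\otimes f]$ and $[1_A\otimes g,\sigma]=[\sigma,g\otimes 1_A]$; $[\sigma_{A,B},\sigma_{B,A}]=1_{A\otimes B}$; and $\sigma_{A,B\otimes C}=[\sigma_{A,B}\otimes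 1_C,1_B\otimes\sigma_{A,C}]$. It is *compact closed* if every object $A$ is given an object $A^*$ and arrows $\eta_A:I\to A^*\otimes A$, $\varepsilon_A:A\otimes A^*\to I$ such that $[1_A\otimes\eta_C,f\otimes 1_C]$, $[g\otimes 1_{C^*},1_B\otimes\varepsilon_C]$, $[\eta_A\otimes 1_B,1_{A^*}\otimes h]$, $[1_A\otimes k,\varepsilon_A\otimes 1_C]$ are defined for all $f:A\otimes C^*\to B$, $g:A\to B\otimes C$, $h:A\otimes B\to C$, $k:B\to A^*\otimes C$, and $[1_A\otimes\eta_A,\varepsilon_A\otimes 1_A]=1_A$, $[\eta_A\otimes 1_{A^*},1_{A^*}\otimes\varepsilon_A]=1_{A^*}$. A functor $F$ between strict symmetric monoidal paracategories is *strict symmetric monoidal* if it preserves $\otimes$ (on objects and arrows), $I$ and $\sigma$ on the nose. Let $(\mathcal C,\mathrm{Tr})$ be a strict symmetric monoidal category with a partial trace. Define $\mathrm{Int}^p(\mathcal C)$ as follows. Objects are pairs $(A^+,A^-)$ of objects of $\mathcal C$; an arrow $(A^+,A^-)\to(B^+,B^-)$ is a morphism $A^+\otimes B^-\to B^+\otimes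 A^-$ of $\mathcal C$. For a path $\vec p=p_1,\dots,p_n$ with $p_i:(A_{i-1}^+,A_{i-1}^-)\to(A_i^+,A_i^-)$ put $\vec A^-=A_0^-\otimes\dots\otimes A_{n-1}^-$ and define $\langle\vec p\rangle:A_0^+\otimes\vec A^-\otimes A_n^-\to A_n^+\otimes A_0^-\otimes\vec A^-$ recursively by $\langle\epsilon\rangle=1$ and $$\langle\vec p,p_{n+1}\rangle=(1\otimes\sigma_{A_n^-,A_0^-\otimes\vec A^-})\circ(p_{n+1}\otimes 1)\circ(1\otimes\sigma_{A_0^-\otimes\vec A^-,A_{n+1}^-})\circ(\langle\vec p\rangle\otimes 1);$$ the composition is $[\vec p]\simeq\mathrm{Tr}^{\vec A^-}(\langle\vec p\rangle\circ(1_{A_0^+}\otimes\sigma_{A_n^-,\vec A^-}))$. The tensor is $(A^+,A^-)\otimes(B^+,B^-)=(A^+\otimes B^+,B^-\otimes A^-)$ with unit $(I,I)$, and for $f:(A^+,A^-)\to(C^+,C^-)$, $g:(B^+,B^-)\to(D^+,D^-)$ the arrow $f\otimes g$ is $(1\otimes\sigma_{A^-,D^+\otimes B^-})\circ(f\otimes_{\mathcal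 C}g)\circ(1\otimes\sigma_{B^+\otimes D^-,C^-})$. The symmetry is $\sigma_{A^+,B^+}\otimes\sigma_{A^-,B^-}$; the dual is $(A,B)^*=(B,A)$, with $\eta_{(A,B)}=1_{B\otimes A}$ and $\varepsilon_{(A,B)}=1_{A\otimes B}$. **Theorem.** For every strict symmetric monoidal category $\mathcal C$ with a partial trace, $\mathrm{Int}^p(\mathcal C)$ is a strict symmetric compact closed paracategory. The category $\mathcal C$, with its total composition, is a strict symmetric monoidal paracategory, and $N(A)=(A,I)$, $N(f)=f$ defines a full and faithful (bijective on each hom-set) strict symmetric monoidal functor of paracategories $N:\mathcal C\to\mathrm{Int}^p(\mathcal C)$. In particular, every partially traced strict symmetric monoidal category has a full and faithful strict symmetric monoidal functor into a compact closed paracategory. -/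

import Mathlib

open CategoryTheory MonoidalCategory

universe v u v' u'

/-! ### Partially traced categories

Partial operations take values in `Part`: equality in `Part` is Kleene equality (both sides
undefined, or both defined and equal) and `≤` in `Part` is directed Kleene equality (if the left
side is defined, then so is the right side, and they are equal). -/

/-- A monoidal category is strict if its associator and unitors are identities. -/
class IsStrictMonoidal (C : Type u) [Category.{v} C] [MonoidalCategory C] : Prop where
  tensor_assoc : ∀ X Y Z : C, (X ⊗ Y) ⊗ Z = X ⊗ (Y ⊗ Z)
  unit_tensor : ∀ X : C, 𝟙_ C ⊗ X = X
  tensor_unit : ∀ X : C, X ⊗ 𝟙_ C = X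
  associator_eq : ∀ X Y Z : C, α_ X Y Z = eqToIso (tensor_assoc X Y Z)
  leftUnitor_eq : ∀ X : C, λ_ X = eqToIso (unit_tensor X)
  rightUnitor_eq : ∀ X : C, ρ_ X = eqToIso (tensor_unit X)

/-- A partial trace on a symmetric monoidal category (the structural isomorphisms, which are
identities in the strict case, are written out). -/
structure PartialTrace (C : Type u) [Category.{v} C] [MonoidalCategory C]
    [SymmetricCategory C] where
  tr : ∀ {A B : C} (U : C), (A ⊗ U ⟶ B ⊗ U) → Part (A ⟶ B)
  naturality : ∀ {A B A' B' U : C} (f : A ⊗ U ⟶ B ⊗ U) (g : A' ⟶ A) (h : B ⟶ B'),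
    (tr U f).map (fun t => g ≫ t ≫ h) ≤ tr U ((g ▷ U) ≫ f ≫ (h ▷ U))
  dinaturality : ∀ {A B U U' : C} (f : A ⊗ U ⟶ B ⊗ U') (g : U' ⟶ U),
    tr U (f ≫ (B ◁ g)) = tr U' ((A ◁ g) ≫ f)
  strength : ∀ {A B U X Y : C} (f : A ⊗ U ⟶ B ⊗ U) (g : X ⟶ Y),
    (tr U f).map (fun t => g ⊗ₘ t) ≤ tr U ((α_ X A U).hom ≫ (g ⊗ₘ f) ≫ (α_ Y B U).inv)
  vanishing_one : ∀ {A B : C} (f : A ⊗ 𝟙_ C ⟶ B ⊗ 𝟙_ C),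
    tr (𝟙_ C) f = Part.some ((ρ_ A).inv ≫ f ≫ (ρ_ B).hom)
  vanishing_two : ∀ {A B U V : C} (f : (A ⊗ U) ⊗ V ⟶ (B ⊗ U) ⊗ V) (h : (tr V f).Dom),
    tr U ((tr V f).get h) = tr (U ⊗ V) ((α_ A U V).inv ≫ f ≫ (α_ B U V).hom)
  yanking : ∀ A : C, tr A (β_ A A).hom = Part.some (𝟙 A)

/-! ### Paracategories -/

/-- A directed graph with a partial operation from paths to arrows: the data of a
paracategory. -/
structure ParaData where
  Obj : Type u
  [quiver : Quiver.{v} Obj]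
  comp : ∀ {A B : Obj}, Quiver.Path A B → Part (A ⟶ B)

attribute [instance] ParaData.quiver

namespace ParaData

/-- The axioms of a paracategory. -/
structure IsParacategory (P : ParaData.{v, u}) : Prop where
  comp_nil_dom : ∀ A : P.Obj, (P.comp (Quiver.Path.nil : Quiver.Path A A)).Dom
  comp_toPath : ∀ {A B : P.Obj} (f : A ⟶ B), P.comp f.toPath = Part.some f
  comp_comp : ∀ {A B C D : P.Obj} (r : Quiver.Path A B) (f : Quiver.Path B C)
    (s : Quiver.Path C D) (h : (P.comp f).Dom),
    P.comp ((r.comp ((P.comp f).get h).toPath).comp s) = P.comp ((r.comp f).comp s)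

/-- The identity arrow `1_A = [ε_A]`. -/
def IsParacategory.one {P : ParaData.{v, u}} (h : P.IsParacategory) (A : P.Obj) : A ⟶ A :=
  (P.comp Quiver.Path.nil).get (h.comp_nil_dom A)

/-- The partial composition `[f, g]` of a path of length two. -/
def comp₂ (P : ParaData.{v, u}) {A B C : P.Obj} (f : A ⟶ B) (g : B ⟶ C) : Part (A ⟶ C) :=
  P.comp (f.toPath.cons g)

/-- A graph homomorphism `F` is a functor of paracategories if `F[p]` is directed Kleene equal to
`[F p]` for every path `p`. -/
def IsFunctor {P : ParaData.{v, u}} {Q : ParaData.{v', u'}} (F : P.Obj ⥤q Q.Obj) : Prop :=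
  ∀ (A B : P.Obj) (p : Quiver.Path A B), (P.comp p).map F.map ≤ Q.comp (F.mapPath p)

/-- The product graph. -/
abbrev prodQuiver (P : ParaData.{v, u}) (Q : ParaData.{v', u'}) :
    Quiver.{max v v'} (P.Obj × Q.Obj) where
  Hom X Y := (X.1 ⟶ Y.1) × (X.2 ⟶ Y.2)

/-- First projection of the product graph. -/
def fst (P : ParaData.{v, u}) (Q : ParaData.{v', u'}) :
    @Prefunctor (P.Obj × Q.Obj) (prodQuiver P Q) P.Obj _ :=
  letI := prodQuiver P Q
  { obj := fun X => X.1, map := fun f => f.1 }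

/-- Second projection of the product graph. -/
def snd (P : ParaData.{v, u}) (Q : ParaData.{v', u'}) :
    @Prefunctor (P.Obj × Q.Obj) (prodQuiver P Q) Q.Obj _ :=
  letI := prodQuiver P Q
  { obj := fun X => X.2, map := fun f => f.2 }

/-- The product: `[(f₁,g₁),…,(fₙ,gₙ)]` is `([f₁,…,fₙ], [g₁,…,gₙ])`, defined when both components
are. -/
def prod (P : ParaData.{v, u}) (Q : ParaData.{v', u'}) : ParaData.{max v v', max u u'} :=
  letI := prodQuiver P Q
  { Obj := P.Obj × Q.Obj
    comp := fun p =>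
      (P.comp ((fst P Q).mapPath p)).bind fun f =>
        (Q.comp ((snd P Q).mapPath p)).map fun g => (f, g) }

end ParaData

/-! ### Symmetric monoidal paracategories -/

/-- The data of a strict symmetric monoidal paracategory. -/
structure SymMonParaData extends ParaData.{v, u} where
  tensor : (ParaData.prod toParaData toParaData).Obj ⥤q Obj
  unit : Obj
  sym : ∀ A B : Obj, tensor.obj (A, B) ⟶ tensor.obj (B, A)

namespace SymMonParaData

/-- The tensor product of objects. -/
abbrev tObj (P : SymMonParaData.{v, u}) (A B : P.Obj) : P.Obj := P.tensor.obj (A, B)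

/-- The tensor product of arrows. -/
abbrev tHom (P : SymMonParaData.{v, u}) {A B A' B' : P.Obj} (f : A ⟶ B) (g : A' ⟶ B') :
    P.tObj A A' ⟶ P.tObj B B' :=
  P.tensor.map (X := (A, A')) (Y := (B, B')) (f, g)

/-- The symmetry. -/
abbrev σ (P : SymMonParaData.{v, u}) (A B : P.Obj) : P.tObj A B ⟶ P.tObj B A := P.sym A B

/-- The axioms of a strict symmetric monoidal paracategory. `Quiver.Hom.cast` transports an
arrow along equalities of its source and target. -/
structure IsStrictSymmetricMonoidal (P : SymMonParaData.{v, u}) : Prop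
    extends P.toParaData.IsParacategory where
  tensor_isFunctor : ParaData.IsFunctor P.tensor
  assoc_obj : ∀ A B C : P.Obj, P.tObj (P.tObj A B) C = P.tObj A (P.tObj B C)
  assoc_hom : ∀ {A B C A' B' C' : P.Obj} (f : A ⟶ A') (g : B ⟶ B') (h : C ⟶ C'),
    (P.tHom (P.tHom f g) h).cast (assoc_obj A B C) (assoc_obj A' B' C') = P.tHom f (P.tHom g h)
  tensor_unit_obj : ∀ A : P.Obj, P.tObj A P.unit = A
  unit_tensor_obj : ∀ A : P.Obj, P.tObj P.unit A = A
  tensor_unit_hom : ∀ {A B : P.Obj} (f : A ⟶ B),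
    (P.tHom f (toIsParacategory.one P.unit)).cast (tensor_unit_obj A) (tensor_unit_obj B) = f
  unit_tensor_hom : ∀ {A B : P.Obj} (f : A ⟶ B),
    (P.tHom (toIsParacategory.one P.unit) f).cast (unit_tensor_obj A) (unit_tensor_obj B) = f
  sym_total_left : ∀ {X A B Y : P.Obj} (f : P.tObj X (P.tObj B A) ⟶ Y),
    (P.comp₂ (P.tHom (toIsParacategory.one X) (P.σ A B)) f).Dom
  sym_total_right : ∀ {X A B Y : P.Obj} (g : Y ⟶ P.tObj X (P.tObj A B)),
    (P.comp₂ g (P.tHom (toIsParacategory.one X) (P.σ A B))).Dom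
  sym_natural_left : ∀ {A A' : P.Obj} (B : P.Obj) (f : A ⟶ A'),
    P.comp₂ (P.tHom f (toIsParacategory.one B)) (P.σ A' B) =
      P.comp₂ (P.σ A B) (P.tHom (toIsParacategory.one B) f)
  sym_natural_right : ∀ (A : P.Obj) {B B' : P.Obj} (g : B ⟶ B'),
    P.comp₂ (P.tHom (toIsParacategory.one A) g) (P.σ A B') =
      P.comp₂ (P.σ A B) (P.tHom g (toIsParacategory.one A))
  sym_sym : ∀ A B : P.Obj,
    P.comp₂ (P.σ A B) (P.σ B A) = Part.some (toIsParacategory.one (P.tObj A B))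
  hexagon : ∀ A B C : P.Obj,
    P.comp₂
      ((P.tHom (P.σ A B) (toIsParacategory.one C)).cast (assoc_obj A B C) (assoc_obj B A C))
      ((P.tHom (toIsParacategory.one B) (P.σ A C)).cast rfl (assoc_obj B C A).symm) =
    Part.some (P.σ A (P.tObj B C))

/-- A strict symmetric monoidal functor. -/
structure IsStrictSymmetricMonoidalFunctor {P : SymMonParaData.{v, u}}
    {Q : SymMonParaData.{v', u'}} (F : P.Obj ⥤q Q.Obj) : Prop where
  isFunctor : ParaData.IsFunctor F
  tensor_obj : ∀ A B : P.Obj, Q.tObj (F.obj A) (F.obj B) = F.obj (P.tObj A B)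
  unit_obj : F.obj P.unit = Q.unit
  tensor_hom : ∀ {A B A' B' : P.Obj} (f : A ⟶ B) (g : A' ⟶ B'),
    (Q.tHom (F.map f) (F.map g)).cast (tensor_obj A A') (tensor_obj B B') = F.map (P.tHom f g)
  sym_hom : ∀ A B : P.Obj,
    (Q.σ (F.obj A) (F.obj B)).cast (tensor_obj A B) (tensor_obj B A) = F.map (P.σ A B)

end SymMonParaData

/-! ### Compact closed paracategories -/

/-- The data of a strict symmetric compact closed paracategory. -/
structure CompactClosedParaData extends SymMonParaData.{v, u} where
  dual : Obj → Obj
  η : ∀ A : Obj, unit ⟶ toSymMonParaData.tObj (dual A) A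
  ε : ∀ A : Obj, toSymMonParaData.tObj A (dual A) ⟶ unit

/-- The axioms of a strict symmetric compact closed paracategory. -/
structure CompactClosedParaData.IsCompactClosed (P : CompactClosedParaData.{v, u}) : Prop
    extends P.toSymMonParaData.IsStrictSymmetricMonoidal where
  total_unit_right : ∀ {A B C : P.Obj} (f : P.tObj A (P.dual C) ⟶ B),
    (P.comp₂ (P.tHom (toIsParacategory.one A) (P.η C))
      ((P.tHom f (toIsParacategory.one C)).cast (assoc_obj A (P.dual C) C) rfl)).Dom
  total_counit_right : ∀ {A B C : P.Obj} (g : A ⟶ P.tObj B C),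
    (P.comp₂
      ((P.tHom g (toIsParacategory.one (P.dual C))).cast rfl (assoc_obj B C (P.dual C)))
      (P.tHom (toIsParacategory.one B) (P.ε C))).Dom
  total_unit_left : ∀ {A B C : P.Obj} (h : P.tObj A B ⟶ C),
    (P.comp₂ ((P.tHom (P.η A) (toIsParacategory.one B)).cast rfl (assoc_obj (P.dual A) A B))
      (P.tHom (toIsParacategory.one (P.dual A)) h)).Dom
  total_counit_left : ∀ {A B C : P.Obj} (k : B ⟶ P.tObj (P.dual A) C),
    (P.comp₂ (P.tHom (toIsParacategory.one A) k)
      ((P.tHom (P.ε A) (toIsParacategory.one C)).cast (assoc_obj A (P.dual A) C) rfl)).Dom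
  snake : ∀ A : P.Obj,
    P.comp₂ ((P.tHom (toIsParacategory.one A) (P.η A)).cast (tensor_unit_obj A) rfl)
      ((P.tHom (P.ε A) (toIsParacategory.one A)).cast (assoc_obj A (P.dual A) A)
        (unit_tensor_obj A)) =
    Part.some (toIsParacategory.one A)
  snake_dual : ∀ A : P.Obj,
    P.comp₂
      ((P.tHom (P.η A) (toIsParacategory.one (P.dual A))).cast (unit_tensor_obj (P.dual A))
        (assoc_obj (P.dual A) A (P.dual A)))
      ((P.tHom (toIsParacategory.one (P.dual A)) (P.ε A)).cast rfl
        (tensor_unit_obj (P.dual A))) =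
    Part.some (toIsParacategory.one (P.dual A))

/-! ### Categories as paracategories -/

/-- A category, with the total composition of paths. -/
abbrev paraOfCategory (C : Type u) [Category.{v} C] : ParaData.{v, u} where
  Obj := C
  comp p := Part.some (composePath p)

/-- A symmetric monoidal category, with the total composition of paths. -/
abbrev symMonParaOfCategory (C : Type u) [Category.{v} C] [MonoidalCategory C]
    [SymmetricCategory C] : SymMonParaData.{v, u} where
  toParaData := paraOfCategory C
  tensor :=
    { obj := fun X => tensorObj (C := C) X.1 X.2
      map := fun f => tensorHom (C := C) f.1 f.2 }
  unit := 𝟙_ C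
  sym := fun A B : C => (β_ A B).hom

/-! ### The partial Int-construction -/

/-- Objects of the partial Int-construction: pairs `(A⁺, A⁻)`. -/
@[ext]
structure IntObj (C : Type u) where
  pos : C
  neg : C

namespace IntObj

variable {C : Type u} [Category.{v} C] [MonoidalCategory C]

/-- An arrow `A ⟶ B` is a morphism `A⁺ ⊗ B⁻ ⟶ B⁺ ⊗ A⁻`. -/
instance : Quiver.{v} (IntObj C) where
  Hom A B := A.pos ⊗ B.neg ⟶ B.pos ⊗ A.neg

/-- The morphism of `C` underlying an arrow. -/
abbrev mor {A B : IntObj C} (f : A ⟶ B) : A.pos ⊗ B.neg ⟶ B.pos ⊗ A.neg := f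

/-- The arrow given by a morphism of `C`. -/
abbrev ofMor {A B : IntObj C} (f : A.pos ⊗ B.neg ⟶ B.pos ⊗ A.neg) : A ⟶ B := f

/-- For a path `A₀, …, Aₙ`, the object `A₀⁻ ⊗ … ⊗ Aₙ₋₁⁻`. -/
def vec {A : IntObj C} : ∀ {B : IntObj C}, Quiver.Path A B → C
  | _, .nil => 𝟙_ C
  | _, .cons (b := B) p _ => vec p ⊗ B.neg

variable [SymmetricCategory C]

/-- Precomposition: `A₀⁺ ⊗ (A₀⁻ ⊗ … ⊗ Aₙ₋₁⁻) ⊗ Aₙ⁻ ⟶ Aₙ⁺ ⊗ A₀⁻ ⊗ (A₀⁻ ⊗ … ⊗ Aₙ₋₁⁻)`, by recursion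
on the path. -/
def precomp {A : IntObj C} : ∀ {B : IntObj C} (p : Quiver.Path A B),
    (A.pos ⊗ (vec p ⊗ B.neg) ⟶ B.pos ⊗ (A.neg ⊗ vec p))
  | _, .nil => A.pos ◁ ((λ_ A.neg).hom ≫ (ρ_ A.neg).inv)
  | D, .cons (b := B) p e =>
    (α_ A.pos (vec p ⊗ B.neg) D.neg).inv ≫
      (precomp p ▷ D.neg) ≫
      (α_ B.pos (A.neg ⊗ vec p) D.neg).hom ≫
      (B.pos ◁ (β_ (A.neg ⊗ vec p) D.neg).hom) ≫
      (α_ B.pos D.neg (A.neg ⊗ vec p)).inv ≫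
      (mor e ▷ (A.neg ⊗ vec p)) ≫
      (α_ D.pos B.neg (A.neg ⊗ vec p)).hom ≫
      (D.pos ◁ (β_ B.neg (A.neg ⊗ vec p)).hom) ≫
      (D.pos ◁ (α_ A.neg (vec p) B.neg).hom)

/-- Partial composition of a path: a single partial trace over `A₀⁻ ⊗ … ⊗ Aₙ₋₁⁻`. -/
def pathComp (T : PartialTrace C) {A B : IntObj C} (p : Quiver.Path A B) : Part (A ⟶ B) :=
  T.tr (vec p)
    ((α_ A.pos B.neg (vec p)).hom ≫ (A.pos ◁ (β_ B.neg (vec p)).hom) ≫ precomp p ≫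
      (α_ B.pos A.neg (vec p)).inv)

/-- `(A⁺, A⁻) ⊗ (B⁺, B⁻) = (A⁺ ⊗ B⁺, B⁻ ⊗ A⁻)`. -/
def tens (A B : IntObj C) : IntObj C := ⟨A.pos ⊗ B.pos, B.neg ⊗ A.neg⟩

/-- The tensor of `f : A ⟶ D` and `g : B ⟶ E`: the symmetry gathers the inputs of `f` and of `g`,
then `f ⊗ g` is applied, and the symmetry rearranges the outputs. -/
def tensHom {A B D E : IntObj C} (f : A ⟶ D) (g : B ⟶ E) : tens A B ⟶ tens D E :=
  ofMor (A := tens A B) (B := tens D E)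
    ((α_ A.pos B.pos (E.neg ⊗ D.neg)).hom ≫
      (A.pos ◁ (α_ B.pos E.neg D.neg).inv) ≫
      (A.pos ◁ (β_ (B.pos ⊗ E.neg) D.neg).hom) ≫
      (α_ A.pos D.neg (B.pos ⊗ E.neg)).inv ≫
      (mor f ⊗ₘ mor g) ≫
      (α_ D.pos A.neg (E.pos ⊗ B.neg)).hom ≫
      (D.pos ◁ (β_ A.neg (E.pos ⊗ B.neg)).hom) ≫
      (D.pos ◁ (α_ E.pos B.neg A.neg).hom) ≫
      (α_ D.pos E.pos (B.neg ⊗ A.neg)).inv)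

/-- The symmetry, the morphism `σ_{A⁺,B⁺} ⊗ σ_{A⁻,B⁻}` from `(A⁺ ⊗ B⁺) ⊗ (A⁻ ⊗ B⁻)` to
`(B⁺ ⊗ A⁺) ⊗ (B⁻ ⊗ A⁻)`. -/
def symm (A B : IntObj C) : tens A B ⟶ tens B A :=
  ofMor (A := tens A B) (B := tens B A) ((β_ A.pos B.pos).hom ⊗ₘ (β_ A.neg B.neg).hom)

/-- The tensor unit `(I, I)`. -/
def one : IntObj C := ⟨𝟙_ C, 𝟙_ C⟩

/-- The dual `(A, B)* = (B, A)`. -/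
def dual (A : IntObj C) : IntObj C := ⟨A.neg, A.pos⟩

/-- The unit of `(A, B)`: up to the unitors, the identity of `B ⊗ A`. -/
def unitHom (A : IntObj C) : one ⟶ tens (dual A) A :=
  ofMor (A := one) (B := tens (dual A) A)
    ((λ_ (A.neg ⊗ A.pos)).hom ≫ (ρ_ (A.neg ⊗ A.pos)).inv)

/-- The counit of `(A, B)`: up to the unitors, the identity of `A ⊗ B`. -/
def counitHom (A : IntObj C) : tens A (dual A) ⟶ one :=
  ofMor (A := tens A (dual A)) (B := one)
    ((ρ_ (A.pos ⊗ A.neg)).hom ≫ (λ_ (A.pos ⊗ A.neg)).inv)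

/-- `N(A) = (A, I)`. -/
def nObj (A : C) : IntObj C := ⟨A, 𝟙_ C⟩

/-- `N(f) = f`, up to the unitors. -/
def nHom {A B : C} (f : A ⟶ B) : nObj A ⟶ nObj B :=
  ofMor (A := nObj A) (B := nObj B) ((ρ_ A).hom ≫ f ≫ (ρ_ B).inv)

end IntObj

section

variable {C : Type u} [Category.{v} C] [MonoidalCategory C] [SymmetricCategory C]

/-- The graph of the partial Int-construction with its partial composition. -/
abbrev intPara (T : PartialTrace C) : ParaData.{v, u} where
  Obj := IntObj C
  comp p := IntObj.pathComp T p

/-- The symmetric monoidal data of the partial Int-construction. -/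
abbrev intSymMon (T : PartialTrace C) : SymMonParaData.{v, u} where
  toParaData := intPara T
  tensor :=
    { obj := fun X => IntObj.tens X.1 X.2
      map := fun f => IntObj.tensHom f.1 f.2 }
  unit := IntObj.one
  sym A B := IntObj.symm A B

/-- The partial Int-construction. -/
abbrev intP (T : PartialTrace C) : CompactClosedParaData.{v, u} where
  toSymMonParaData := intSymMon T
  dual := fun A : IntObj C => IntObj.dual A
  η := fun A : IntObj C => IntObj.unitHom A
  ε := fun A : IntObj C => IntObj.counitHom A

/-- The graph homomorphism `N` from `C` to the partial Int-construction. -/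
def intN (T : PartialTrace C) : (symMonParaOfCategory C).Obj ⥤q (intP T).Obj where
  obj := fun A : C => IntObj.nObj A
  map := fun {A B : C} (f : A ⟶ B) => IntObj.nHom f

end

/-!
The identities between morphisms of `C` are identities of string diagrams. By coherence for
symmetric monoidal categories such a diagram is determined by its boxes and by the way in which
they are connected, which can be compared combinatorially. Coherence itself reduces to words with
at most one wire, because the interchange of two tensor products splits off one wire at a time.

Replacing a subpath by its composite has to be allowed inside a larger diagram, but having equal
traces is not preserved by contexts. The equivalence relation on morphisms with feedback that is
generated by sliding (dinaturality) and by evaluation of an inner trace that is defined (vanishing)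
is preserved, and it implies equality of traces. Up to this relation, `⟨p, q⟩` with its feedback is
the composition of `⟨p⟩` and `⟨q⟩` with theirs; this gives the associativity of the composition of
paths and, as `⊗` acts through contexts too, the functoriality of `⊗`.

The composites that have to be defined are traces of diagrams whose loops can be straightened by
yanking.
-/

/-! ### Coherence for symmetric monoidal categories -/

namespace Wiring

/-- Bracketed tensor words in wires labelled by `ι`. Diagrams are compared through the words at
their two ends, so that associators and unitors become invisible. -/
inductive Word (ι : Type*)
  | unit : Word ι
  | wire : ι → Word ι
  | tensor : Word ι → Word ι → Word ι

namespace Word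

variable {ι : Type*}

/-- The wires of a word, in order. -/
def toList : Word ι → List ι
  | unit => []
  | wire i => [i]
  | tensor X Y => X.toList ++ Y.toList

/-- The word on a list of wires that is bracketed to the right. -/
def ofList : List ι → Word ι
  | [] => unit
  | i :: l => tensor (wire i) (ofList l)

theorem toList_ofList : ∀ l : List ι, (ofList l).toList = l
  | [] => rfl
  | i :: l => congrArg (i :: ·) (toList_ofList l)

end Word

open Word

/-- Formal composites of structural isomorphisms of a symmetric monoidal category. -/
inductive FormalIso {ι : Type*} : Word ι → Word ι → Type _
  | refl X : FormalIso X X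
  | symm {X Y} : FormalIso X Y → FormalIso Y X
  | trans {X Y Z} : FormalIso X Y → FormalIso Y Z → FormalIso X Z
  | tensor {X Y X' Y'} : FormalIso X Y → FormalIso X' Y' → FormalIso (tensor X X') (tensor Y Y')
  | associator X Y Z : FormalIso (.tensor (.tensor X Y) Z) (.tensor X (.tensor Y Z))
  | leftUnitor X : FormalIso (.tensor unit X) X
  | rightUnitor X : FormalIso (.tensor X unit) X
  | braiding X Y : FormalIso (.tensor X Y) (.tensor Y X)

namespace FormalIso

variable {ι : Type*}

theorem toList_perm {X Y : Word ι} (f : FormalIso X Y) : X.toList.Perm Y.toList := by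
  induction f with
  | refl => exact .refl _
  | symm _ ih => exact ih.symm
  | trans _ _ ihf ihg => exact ihf.trans ihg
  | tensor _ _ ihf ihg => exact ihf.append ihg
  | associator => simp [toList]
  | leftUnitor => simp [toList]
  | rightUnitor => simp [toList]
  | braiding => exact List.perm_append_comm

/-- Rebracketing the concatenation of two words bracketed to the right. -/
def ofListAppend : ∀ l m : List ι, FormalIso (.tensor (ofList l) (ofList m)) (ofList (l ++ m))
  | [], m => leftUnitor (ofList m)
  | i :: l, m => (associator _ _ _).trans ((refl (wire i)).tensor (ofListAppend l m))

/-- Rebracketing a word to the right. -/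
def normalize : ∀ X : Word ι, FormalIso X (ofList X.toList)
  | unit => refl unit
  | wire i => (rightUnitor (wire i)).symm
  | .tensor X Y => ((normalize X).tensor (normalize Y)).trans (ofListAppend X.toList Y.toList)

theorem nonempty_ofList {l m : List ι} (h : l.Perm m) :
    Nonempty (FormalIso (ofList l) (ofList m)) := by
  induction h with
  | nil => exact ⟨refl _⟩
  | cons i _ ih => exact ih.map (refl (wire i)).tensor
  | swap i j l =>
    exact ⟨(associator _ _ _).symm.trans <| ((braiding _ _).tensor (refl _)).trans
      (associator _ _ _)⟩
  | trans _ _ ihf ihg => exact ihf.elim fun f => ihg.map f.trans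

theorem nonempty_of_perm {X Y : Word ι} (h : X.toList.Perm Y.toList) : Nonempty (FormalIso X Y) :=
  (nonempty_ofList h).map fun f => (normalize X).trans (f.trans (normalize Y).symm)

end FormalIso

section Coherence

variable {ι : Type*} {C : Type u} [Category.{v} C] [MonoidalCategory C]

/-- The object denoted by a word under a valuation of its wires. -/
def Word.eval (w : ι → C) : Word ι → C
  | unit => 𝟙_ C
  | wire i => w i
  | tensor X Y => X.eval w ⊗ Y.eval w

/-- Isomorphic valuations of the wires of a word give isomorphic objects. -/
def Word.mapIso {w w' : ι → C} :
    ∀ X : Word ι, (∀ i ∈ X.toList, w i ≅ w' i) → (X.eval w ≅ X.eval w')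
  | unit, _ => Iso.refl (𝟙_ C)
  | wire i, e => e i (List.mem_singleton_self i)
  | tensor X Y, e => X.mapIso (fun i hi => e i (List.mem_append_left _ hi)) ⊗ᵢ
      Y.mapIso (fun i hi => e i (List.mem_append_right _ hi))

theorem commSq_tensorHom {X Y Z W X' Y' Z' W' : C} {f : X ⟶ Y} {g : X ⟶ Z} {h : Y ⟶ W} {i : Z ⟶ W}
    {f' : X' ⟶ Y'} {g' : X' ⟶ Z'} {h' : Y' ⟶ W'} {i' : Z' ⟶ W'}
    (s : CommSq f g h i) (s' : CommSq f' g' h' i') :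
    CommSq (f ⊗ₘ f') (g ⊗ₘ g') (h ⊗ₘ h') (i ⊗ₘ i') :=
  ⟨by rw [tensorHom_comp_tensorHom, tensorHom_comp_tensorHom, s.w, s'.w]⟩

theorem commSq_associator {A B D A' B' D' AB BD L R : C} (a : A ⟶ A') (b : B ⟶ B') (d : D ⟶ D')
    {m : A' ⊗ B' ⟶ AB} {n : AB ⊗ D' ⟶ L} {m' : B' ⊗ D' ⟶ BD} {n' : A' ⊗ BD ⟶ R} {e : L ⟶ R}
    (h : m ▷ D' ≫ n ≫ e = (α_ A' B' D').hom ≫ A' ◁ m' ≫ n') :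
    CommSq (α_ A B D).hom ((((a ⊗ₘ b) ≫ m) ⊗ₘ d) ≫ n) ((a ⊗ₘ ((b ⊗ₘ d) ≫ m')) ≫ n') e where
  w := by
    have hl : ((a ⊗ₘ b) ≫ m) ⊗ₘ d = ((a ⊗ₘ b) ⊗ₘ d) ≫ m ▷ D' := by
      rw [← tensorHom_id, tensorHom_comp_tensorHom, Category.comp_id]
    have hr : a ⊗ₘ ((b ⊗ₘ d) ≫ m') = (a ⊗ₘ (b ⊗ₘ d)) ≫ A' ◁ m' := by
      rw [← id_tensorHom, tensorHom_comp_tensorHom, Category.comp_id]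
    rw [hl, hr, Category.assoc, Category.assoc, Category.assoc, h, associator_naturality_assoc]

theorem commSq_leftUnitor {A A' U L : C} (a : A ⟶ A') {u : 𝟙_ C ⟶ U} {m : U ⊗ A' ⟶ L}
    {e : L ⟶ A'} (h : (λ_ A').hom = u ▷ A' ≫ m ≫ e) :
    CommSq (λ_ A).hom ((u ⊗ₘ a) ≫ m) a e where
  w := by
    rw [MonoidalCategory.tensorHom_def', Category.assoc, Category.assoc, ← h, leftUnitor_naturality]

theorem commSq_rightUnitor {A A' U L : C} (a : A ⟶ A') {u : 𝟙_ C ⟶ U} {m : A' ⊗ U ⟶ L}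
    {e : L ⟶ A'} (h : (ρ_ A').hom = A' ◁ u ≫ m ≫ e) :
    CommSq (ρ_ A).hom ((a ⊗ₘ u) ≫ m) a e where
  w := by
    rw [MonoidalCategory.tensorHom_def, Category.assoc, Category.assoc, ← h, rightUnitor_naturality]

/-- The power `A ^ n` for `n ≤ 1`; larger exponents are not used. -/
def power (A : C) : ℕ → C
  | 0 => 𝟙_ C
  | _ => A

/-- The structural isomorphism `A ^ a ⊗ A ^ b ≅ A ^ (a + b)` for `a + b ≤ 1`. -/
def powerMul (A : C) : ∀ {a b n : ℕ}, a + b = n → n ≤ 1 → (power A a ⊗ power A b ≅ power A n)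
  | 0, 0, _, rfl, _ => λ_ (𝟙_ C)
  | 0, 1, _, rfl, _ => λ_ A
  | 1, 0, _, rfl, _ => ρ_ A
  | 1, 1, _, rfl, h => absurd h (by omega)
  | 0, _ + 2, _, rfl, h => absurd h (by omega)
  | 1, _ + 2, _, rfl, h => absurd h (by omega)
  | _ + 2, _, _, rfl, h => absurd h (by omega)

theorem powerMul_associator (A : C) {a b c ab bc n : ℕ} (hab : a + b = ab) (hbc : b + c = bc)
    (hl : ab + c = n) (hr : a + bc = n) (hn : n ≤ 1) :
    (powerMul A hab (by omega)).hom ▷ _ ≫ (powerMul A hl hn).hom ≫ 𝟙 _ =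
      (α_ _ _ _).hom ≫ _ ◁ (powerMul A hbc (by omega)).hom ≫ (powerMul A hr hn).hom := by
  subst hab hbc hl
  obtain ⟨rfl, rfl, rfl⟩ | ⟨rfl, rfl, rfl⟩ | ⟨rfl, rfl, rfl⟩ | ⟨rfl, rfl, rfl⟩ :
    (a = 0 ∧ b = 0 ∧ c = 0) ∨ (a = 1 ∧ b = 0 ∧ c = 0) ∨ (a = 0 ∧ b = 1 ∧ c = 0) ∨
      (a = 0 ∧ b = 0 ∧ c = 1) := by omega
  all_goals
    dsimp [powerMul, power]
    monoidal

theorem powerMul_zero_left (A : C) {a : ℕ} (ha : a ≤ 1) :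
    powerMul A (Nat.zero_add a) ha = λ_ (power A a) := by
  obtain rfl | rfl : a = 0 ∨ a = 1 := by omega
  all_goals rfl

theorem powerMul_zero_right (A : C) {a : ℕ} (ha : a ≤ 1) :
    powerMul A (Nat.add_zero a) ha = ρ_ (power A a) := by
  obtain rfl | rfl : a = 0 ∨ a = 1 := by omega
  · exact Iso.ext unitors_equal
  · rfl

/-- The number of wires of a word, counted with weights. -/
def Word.weight (m : ι → ℕ) (X : Word ι) : ℕ := (X.toList.map m).sum

theorem Word.weight_tensor (m : ι → ℕ) (X Y : Word ι) :
    (tensor X Y).weight m = X.weight m + Y.weight m := by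
  simp [weight, toList]

theorem Word.weight_single [DecidableEq ι] (i : ι) (X : Word ι) :
    X.weight (Pi.single i 1) = X.toList.count i := by
  rw [weight]
  induction X.toList with
  | nil => rfl
  | cons j l ih => simp [ih, List.count_cons, Pi.single_apply, add_comm]

/-- A word with at most one wire that is not labelled by the unit, with its units removed. -/
def Word.collapse (A : C) (m : ι → ℕ) :
    ∀ (X : Word ι) {n : ℕ}, X.weight m = n → n ≤ 1 → (X.eval (fun i => power A (m i)) ≅ power A n)
  | unit, _, h, _ => eqToIso (congrArg (power A) h)
  | wire _, _, h, _ => eqToIso (congrArg (power A) h)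
  | tensor X Y, _, h, hn =>
    have h' : X.weight m + Y.weight m = _ := (Word.weight_tensor m X Y).symm.trans h
    (X.collapse A m rfl (by omega) ⊗ᵢ Y.collapse A m rfl (by omega)) ≪≫ powerMul A h' hn

theorem Word.collapse_tensor (A : C) (m : ι → ℕ) {X Y : Word ι} {a b n : ℕ} (ha : X.weight m = a)
    (hb : Y.weight m = b) (h : a + b = n) (hn : n ≤ 1) :
    (tensor X Y).collapse A m ((weight_tensor m X Y).trans (by rw [ha, hb, h])) hn =
      (X.collapse A m ha (by omega) ⊗ᵢ Y.collapse A m hb (by omega)) ≪≫ powerMul A h hn := by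
  subst ha hb
  rfl

variable [SymmetricCategory C]

/-- The structural isomorphism denoted by a formal composite. -/
def FormalIso.eval (w : ι → C) : ∀ {X Y : Word ι}, FormalIso X Y → (X.eval w ≅ Y.eval w)
  | _, _, refl X => Iso.refl (X.eval w)
  | _, _, symm f => (f.eval w).symm
  | _, _, trans f g => f.eval w ≪≫ g.eval w
  | _, _, tensor f g => f.eval w ⊗ᵢ g.eval w
  | _, _, associator X Y Z => α_ (X.eval w) (Y.eval w) (Z.eval w)
  | _, _, leftUnitor X => λ_ (X.eval w)
  | _, _, rightUnitor X => ρ_ (X.eval w)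
  | _, _, braiding X Y => β_ (X.eval w) (Y.eval w)

theorem tensorμ_braiding (X₁ X₂ Y₁ Y₂ : C) :
    (β_ (X₁ ⊗ X₂) (Y₁ ⊗ Y₂)).hom ≫ tensorμ Y₁ Y₂ X₁ X₂ =
      tensorμ X₁ X₂ Y₁ Y₂ ≫ ((β_ X₁ Y₁).hom ⊗ₘ (β_ X₂ Y₂).hom) := by
  simp [tensorμ, SymmetricCategory.braiding_swap_eq_inv_braiding Y₁ X₂,
    SymmetricCategory.braiding_swap_eq_inv_braiding Y₂ X₁, MonoidalCategory.tensorHom_def]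

/-- A word in a product of two valuations is the product of its values. -/
def Word.split (w w' : ι → C) :
    ∀ X : Word ι, X.eval (fun i => w i ⊗ w' i) ≅ X.eval w ⊗ X.eval w'
  | unit => (λ_ (𝟙_ C)).symm
  | wire _ => Iso.refl _
  | tensor X Y => (X.split w w' ⊗ᵢ Y.split w w') ≪≫
      ⟨tensorμ _ _ _ _, tensorδ _ _ _ _, tensorμ_tensorδ _ _ _ _, tensorδ_tensorμ _ _ _ _⟩

namespace FormalIso

theorem eval_mapIso {w w' : ι → C} {X Y : Word ι} (f : FormalIso X Y)
    (e : ∀ i ∈ X.toList, w i ≅ w' i) :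
    CommSq (f.eval w).hom (X.mapIso e).hom
      (Y.mapIso fun i hi => e i (f.toList_perm.mem_iff.2 hi)).hom (f.eval w').hom := by
  induction f with
  | refl => exact ⟨(Category.id_comp _).trans (Category.comp_id _).symm⟩
  | symm f ih =>
    exact (ih fun i hi => e i (f.toList_perm.mem_iff.1 hi)).horiz_inv
  | trans f g ihf ihg => exact (ihf e).horiz_comp (ihg _)
  | tensor f g ihf ihg => exact commSq_tensorHom (ihf _) (ihg _)
  | associator => exact ⟨(associator_naturality _ _ _).symm⟩
  | leftUnitor X =>
    constructor
    change (λ_ _).hom ≫ _ = (𝟙 _ ⊗ₘ _) ≫ (λ_ _).hom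
    rw [id_tensorHom, leftUnitor_naturality]
  | rightUnitor =>
    constructor
    change (ρ_ _).hom ≫ _ = (_ ⊗ₘ 𝟙 _) ≫ (ρ_ _).hom
    rw [tensorHom_id, rightUnitor_naturality]
  | braiding => exact ⟨(BraidedCategory.braiding_naturality _ _).symm⟩

theorem eval_split (w w' : ι → C) {X Y : Word ι} (f : FormalIso X Y) :
    CommSq (f.eval fun i => w i ⊗ w' i).hom (X.split w w').hom (Y.split w w').hom
      ((f.eval w).hom ⊗ₘ (f.eval w').hom) := by
  induction f with
  | refl => exact ⟨by simp [eval]⟩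
  | symm f ih => exact ih.horiz_inv (i := f.eval w ⊗ᵢ f.eval w')
  | trans f g ihf ihg =>
    simpa only [tensorHom_comp_tensorHom] using! ihf.horiz_comp ihg
  | tensor f g ihf ihg =>
    exact (commSq_tensorHom ihf ihg).vert_comp ⟨tensorμ_natural _ _ _ _⟩
  | associator => exact commSq_associator _ _ _ (tensor_associativity ..)
  | leftUnitor => exact commSq_leftUnitor _ (tensor_left_unitality _ _)
  | rightUnitor => exact commSq_rightUnitor _ (tensor_right_unitality _ _)
  | braiding =>
    exact CommSq.vert_comp ⟨(BraidedCategory.braiding_naturality _ _).symm⟩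
      ⟨tensorμ_braiding _ _ _ _⟩

end FormalIso

theorem powerMul_braiding (A : C) {a b n : ℕ} (h : a + b = n) (h' : b + a = n) (hn : n ≤ 1) :
    (β_ _ _).hom ≫ (powerMul A h' hn).hom = (powerMul A h hn).hom := by
  subst h
  obtain ⟨rfl, rfl⟩ | ⟨rfl, rfl⟩ | ⟨rfl, rfl⟩ :
    (a = 0 ∧ b = 0) ∨ (a = 1 ∧ b = 0) ∨ (a = 0 ∧ b = 1) := by omega
  · exact (braiding_leftUnitor (𝟙_ C)).trans unitors_equal.symm
  · exact braiding_leftUnitor A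
  · exact braiding_rightUnitor A

namespace FormalIso

theorem weight_eq (m : ι → ℕ) {X Y : Word ι} (f : FormalIso X Y) : X.weight m = Y.weight m :=
  (f.toList_perm.map m).sum_eq

theorem eval_collapse (A : C) (m : ι → ℕ) {X Y : Word ι} (f : FormalIso X Y) {n : ℕ}
    (hX : X.weight m = n) (hY : Y.weight m = n) (hn : n ≤ 1) :
    CommSq (f.eval fun i => power A (m i)).hom (X.collapse A m hX hn).hom
      (Y.collapse A m hY hn).hom (𝟙 (power A n)) := by
  induction f generalizing n with
  | refl => exact ⟨(Category.id_comp _).trans (Category.comp_id _).symm⟩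
  | symm f ih => exact (ih hY hX hn).horiz_inv (i := Iso.refl _)
  | trans f g ihf ihg =>
    have hY' := (f.weight_eq m).symm.trans hX
    simpa only [Category.comp_id] using! (ihf hX hY' hn).horiz_comp (ihg hY' hY hn)
  | @tensor X₁ Y₁ X₂ Y₂ f g ihf ihg =>
    have hn' : X₁.weight m + X₂.weight m = n := (weight_tensor m X₁ X₂).symm.trans hX
    have h := commSq_tensorHom (ihf rfl (f.weight_eq m).symm (by omega))
      (ihg rfl (g.weight_eq m).symm (by omega))
    rw [collapse_tensor A m (f.weight_eq m).symm (g.weight_eq m).symm hn' hn]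
    exact h.vert_comp ⟨by simp⟩
  | associator =>
    exact commSq_associator _ _ _ (powerMul_associator ..)
  | leftUnitor =>
    subst hY
    exact commSq_leftUnitor (u := 𝟙 _) (m := (powerMul A (Nat.zero_add _) hn).hom) (e := 𝟙 _) _
      (by simp [powerMul_zero_left])
  | rightUnitor =>
    subst hY
    exact commSq_rightUnitor (u := 𝟙 _) (m := (powerMul A (Nat.add_zero _) hn).hom) (e := 𝟙 _) _
      (by simp [powerMul_zero_right])
  | braiding =>
    refine CommSq.vert_comp ⟨(BraidedCategory.braiding_naturality _ _).symm⟩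
      ⟨(powerMul_braiding ..).trans (Category.comp_id _).symm⟩

theorem eval_eq_of_iso {w w' : ι → C} {X Y : Word ι} {f g : FormalIso X Y}
    (e : ∀ i ∈ X.toList, w i ≅ w' i) (h : f.eval w' = g.eval w') : f.eval w = g.eval w := by
  ext
  rw [← cancel_mono (Y.mapIso fun i hi => e i (f.toList_perm.mem_iff.2 hi)).hom,
    (f.eval_mapIso e).w, (g.eval_mapIso e).w, h]

theorem eval_prod_eq {w w' : ι → C} {X Y : Word ι} {f g : FormalIso X Y}
    (h : f.eval w = g.eval w) (h' : f.eval w' = g.eval w') :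
    f.eval (fun i => w i ⊗ w' i) = g.eval (fun i => w i ⊗ w' i) := by
  ext
  rw [← cancel_mono (Y.split w w').hom, (f.eval_split w w').w, (g.eval_split w w').w, h, h']

theorem eval_power_eq (A : C) (m : ι → ℕ) {X Y : Word ι} (f g : FormalIso X Y)
    (hX : X.weight m ≤ 1) :
    f.eval (fun i => power A (m i)) = g.eval (fun i => power A (m i)) := by
  ext
  have hY := f.weight_eq m
  rw [← cancel_mono (Y.collapse A m hY.symm hX).hom, (f.eval_collapse A m rfl hY.symm hX).w,
    (g.eval_collapse A m rfl hY.symm hX).w]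

/-- The induction splits off the wires `i ∈ l` one at a time. -/
theorem eval_eq_of_unit {X Y : Word ι} (hX : X.toList.Nodup) (f g : FormalIso X Y) (l : List ι)
    (w : ι → C) (hw : ∀ i ∈ X.toList, i ∉ l → w i = 𝟙_ C) : f.eval w = g.eval w := by
  classical
  induction l generalizing w with
  | nil =>
    exact eval_eq_of_iso (fun i hi => eqToIso (hw i hi List.not_mem_nil))
      (eval_power_eq (𝟙_ C) (fun _ => 0) f g (by simp [weight]))
  | cons j l ih =>
    let w' := Function.update w j (𝟙_ C)
    have hj : X.weight (Pi.single j 1) ≤ 1 :=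
      (weight_single j X).trans_le (List.nodup_iff_count_le_one.1 hX j)
    refine eval_eq_of_iso (fun i _ => ?_)
      (eval_prod_eq (eval_power_eq (w j) (Pi.single j 1) f g hj) (ih w' fun i hi hil => ?_))
    · by_cases h : i = j
      · subst h
        exact (ρ_ _).symm ≪≫ eqToIso (by simp [w', power])
      · exact (λ_ _).symm ≪≫ eqToIso (by simp [w', power, h])
    · by_cases h : i = j
      · simp [w', h]
      · simpa [w', h] using hw i hi (by simp [h, hil])

theorem eval_eq {X Y : Word ι} (hX : X.toList.Nodup) (f g : FormalIso X Y) (w : ι → C) :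
    f.eval w = g.eval w :=
  eval_eq_of_unit hX f g X.toList w fun _ hi hi' => absurd hi hi'

end FormalIso

end Coherence
end Wiring

/-! ### String diagrams -/

namespace Wiring
open Word

section Diagrams

variable {C : Type u} [Category.{v} C] [MonoidalCategory C] {ι : Type*}

/-- A morphism of `C`, to be used as a box with labelled input and output wires. -/
structure Box (w : ι → C) where
  dom : Word ι
  cod : Word ι
  hom : dom.eval w ⟶ cod.eval w

variable {w : ι → C}

/-- The wires produced by a list of boxes. -/
def outputs (l : List (Box w)) : List ι := l.flatMap fun b => b.cod.toList

variable (w) in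
/-- String diagrams in sequential form: the boxes of a list are applied one after the other to the
first factor, with structural isomorphisms in between. -/
inductive Sequential : List (Box w) → Word ι → Word ι → Type _
  | nil {X Y} (t : FormalIso X Y) : Sequential [] X Y
  | cons {l X Y R} (b : Box w) (t : FormalIso X (.tensor b.dom R))
      (d : Sequential l (.tensor b.cod R) Y) : Sequential (b :: l) X Y

theorem Sequential.mem_of_mem_dom {l : List (Box w)} {X Y : Word ι} (d : Sequential w l X Y)
    {b : Box w} (hb : b ∈ l) {i : ι} (hi : i ∈ b.dom.toList) : i ∈ X.toList ++ outputs l := by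
  induction d with
  | nil => simp at hb
  | cons c t _ ih =>
    have hX := t.toList_perm.mem_iff (a := i)
    simp only [toList, outputs, List.flatMap_cons, List.mem_append] at hX ih ⊢
    rcases List.mem_cons.1 hb with rfl | hb
    · exact .inl (hX.2 (.inl hi))
    · rcases ih hb with (h | h) | h <;> simp [h, hX]

theorem box_comp {A B R X Y Z : C} (p : X ⟶ A ⊗ R) (h : A ⟶ B) (f : B ⊗ R ⟶ Y) (g : Y ⟶ Z) :
    p ≫ h ▷ R ≫ f ≫ g = (p ≫ h ▷ R ≫ f) ≫ g := by
  simp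

theorem box_whiskerRight {A B R X Y : C} (p : X ⟶ A ⊗ R) (h : A ⟶ B) (f : B ⊗ R ⟶ Y) (Z : C) :
    ((p ⊗ₘ 𝟙 Z) ≫ (α_ A R Z).hom) ≫ h ▷ (R ⊗ Z) ≫ (α_ B R Z).inv ≫ f ▷ Z =
      (p ≫ h ▷ R ≫ f) ▷ Z := by
  simp

theorem box_whisker_exchange {A B R S X Y : C} (p : X ⟶ A ⊗ R) (h : A ⟶ B) (s : R ⟶ S)
    (g : B ⊗ S ⟶ Y) : p ≫ h ▷ R ≫ B ◁ s ≫ g = (p ≫ A ◁ s) ≫ h ▷ S ≫ g := by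
  rw [Category.assoc, whisker_exchange_assoc]

variable [SymmetricCategory C]

/-- Exchange of the first two of three factors. -/
def swapFront (A B D : C) : A ⊗ (B ⊗ D) ⟶ B ⊗ (A ⊗ D) :=
  (α_ A B D).inv ≫ (β_ A B).hom ▷ D ≫ (α_ B A D).hom

theorem swapFront_naturality {A B A' B' : C} (f : A ⟶ A') (g : B ⟶ B') (D : C) :
    (f ⊗ₘ g ▷ D) ≫ swapFront A' B' D = swapFront A B D ≫ (g ⊗ₘ f ▷ D) := by
  unfold swapFront
  simp only [← tensorHom_id, associator_inv_naturality_assoc, tensorHom_comp_tensorHom_assoc,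
    BraidedCategory.braiding_naturality, Category.comp_id, Category.assoc]
  rw [← associator_naturality, tensorHom_comp_tensorHom_assoc, Category.id_comp]

theorem swapFront_swapFront (A B D : C) : swapFront A B D ≫ swapFront B A D = 𝟙 _ := by
  simp [swapFront, SymmetricCategory.braiding_swap_eq_inv_braiding B A]

theorem box_whiskerLeft {A B R X Y : C} (p : X ⟶ A ⊗ R) (h : A ⟶ B) (f : B ⊗ R ⟶ Y) (Z : C) :
    (Z ◁ p ≫ swapFront Z A R) ≫ h ▷ (Z ⊗ R) ≫ swapFront B Z R ≫ Z ◁ f =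
      Z ◁ (p ≫ h ▷ R ≫ f) := by
  have hh : swapFront Z A R ≫ h ▷ (Z ⊗ R) = Z ◁ h ▷ R ≫ swapFront Z B R := by
    simpa using (swapFront_naturality (𝟙 Z) h R).symm
  rw [Category.assoc, reassoc_of% hh, reassoc_of% (swapFront_swapFront Z B R),
    whiskerLeft_comp, whiskerLeft_comp]

theorem exchange_of_swapFront {A A' B B' R S T X Y : C} (p : X ⟶ A ⊗ S) (f : A ⟶ A') (g : B ⟶ B')
    (s : S ⟶ B ⊗ R) (t : A' ⊗ R ⟶ T) (q : B' ⊗ T ⟶ Y) :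
    p ≫ f ▷ S ≫ (A' ◁ s ≫ swapFront A' B R ≫ B ◁ t) ≫ g ▷ T ≫ q =
      (p ≫ A ◁ s ≫ swapFront A B R) ≫ g ▷ (A ⊗ R) ≫ swapFront B' A R ≫ f ▷ (B' ⊗ R) ≫
        (swapFront A' B' R ≫ B' ◁ t) ≫ q := by
  have hg : swapFront A B R ≫ g ▷ (A ⊗ R) = A ◁ g ▷ R ≫ swapFront A B' R := by
    simpa using (swapFront_naturality (𝟙 A) g R).symm
  have hg' : A' ◁ g ▷ R ≫ swapFront A' B' R = swapFront A' B R ≫ g ▷ (A' ⊗ R) := by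
    simpa using swapFront_naturality (𝟙 A') g R
  simp only [Category.assoc]
  rw [reassoc_of% hg, reassoc_of% (swapFront_swapFront A B' R), whisker_exchange_assoc,
    whisker_exchange_assoc, whisker_exchange_assoc, reassoc_of% hg']

namespace FormalIso

/-- A structural isomorphism next to further wires on the right. -/
def whiskerRight {X Y : Word ι} (t : FormalIso X Y) (Z : Word ι) :
    FormalIso (.tensor X Z) (.tensor Y Z) :=
  t.tensor (.refl Z)

theorem eval_whiskerRight {X Y : Word ι} (t : FormalIso X Y) (Z : Word ι) :
    ((t.whiskerRight Z).eval w).hom = (t.eval w).hom ▷ Z.eval w :=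
  tensorHom_id _ _

/-- A structural isomorphism next to further wires on the left. -/
def whiskerLeft {X Y : Word ι} (Z : Word ι) (t : FormalIso X Y) :
    FormalIso (.tensor Z X) (.tensor Z Y) :=
  (FormalIso.refl Z).tensor t

theorem eval_whiskerLeft {X Y : Word ι} (Z : Word ι) (t : FormalIso X Y) :
    ((t.whiskerLeft Z).eval w).hom = Z.eval w ◁ (t.eval w).hom :=
  id_tensorHom _ _

/-- Exchange of the first two of three words. -/
def swapFront (X Y Z : Word ι) :
    FormalIso (.tensor X (.tensor Y Z)) (.tensor Y (.tensor X Z)) :=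
  (associator X Y Z).symm.trans (((braiding X Y).whiskerRight Z).trans (associator Y X Z))

theorem eval_swapFront (X Y Z : Word ι) :
    ((swapFront X Y Z).eval w).hom = Wiring.swapFront (X.eval w) (Y.eval w) (Z.eval w) := by
  change _ ≫ (((braiding X Y).whiskerRight Z).eval w).hom ≫ _ = _
  rw [eval_whiskerRight]
  rfl

theorem exists_tensor_of_subset {X Y : Word ι} (hY : Y.toList.Nodup) (h : Y.toList ⊆ X.toList) :
    ∃ R : Word ι, Nonempty (FormalIso X (.tensor Y R)) := by
  obtain ⟨l, hl, hlX⟩ := hY.subperm h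
  obtain ⟨r, hr⟩ := hlX.exists_perm_append
  refine ⟨ofList r, (nonempty_of_perm (Y := .tensor (ofList Y.toList) (ofList r)) ?_).map fun t =>
    t.trans ((normalize Y).symm.whiskerRight _)⟩
  simpa only [toList, toList_ofList] using hr.trans (hl.append_right r)

end FormalIso

namespace Sequential

/-- The morphism denoted by a string diagram in sequential form. -/
def eval : ∀ {l : List (Box w)} {X Y : Word ι}, Sequential w l X Y → (X.eval w ⟶ Y.eval w)
  | _, _, _, nil t => (t.eval w).hom
  | _, _, _, cons (R := R) b t d => (t.eval w).hom ≫ b.hom ▷ R.eval w ≫ d.eval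

/-- Precomposition with a structural isomorphism. -/
def precomp {X Y : Word ι} (t : FormalIso X Y) :
    ∀ {l : List (Box w)} {Z : Word ι}, Sequential w l Y Z → Sequential w l X Z
  | _, _, nil t' => nil (t.trans t')
  | _, _, cons b t' d => cons b (t.trans t') d

theorem eval_precomp {l : List (Box w)} {X Y Z : Word ι} (t : FormalIso X Y)
    (d : Sequential w l Y Z) : (d.precomp t).eval = (t.eval w).hom ≫ d.eval := by
  cases d with
  | nil => rfl
  | cons => exact Category.assoc _ _ _

/-- Composition of string diagrams in sequential form. -/
def comp {l' : List (Box w)} {Y Z : Word ι} (e : Sequential w l' Y Z) :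
    ∀ {l : List (Box w)} {X : Word ι}, Sequential w l X Y → Sequential w (l ++ l') X Z
  | _, _, nil t => e.precomp t
  | _, _, cons b t d => cons b t (e.comp d)

theorem eval_comp {l l' : List (Box w)} {X Y Z : Word ι} (d : Sequential w l X Y)
    (e : Sequential w l' Y Z) : (e.comp d).eval = d.eval ≫ e.eval := by
  induction d with
  | nil t => exact eval_precomp t e
  | cons b t d ih =>
    rw [comp, eval, ih]
    exact box_comp _ _ _ _

/-- A string diagram in sequential form next to further wires. -/
def whiskerRight (Z : Word ι) : ∀ {l : List (Box w)} {X Y : Word ι},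
    Sequential w l X Y → Sequential w l (.tensor X Z) (.tensor Y Z)
  | _, _, _, nil t => nil (t.whiskerRight Z)
  | _, _, _, cons b t d => cons b ((t.whiskerRight Z).trans (.associator _ _ Z))
      ((d.whiskerRight Z).precomp (.symm (.associator _ _ Z)))

theorem eval_whiskerRight {l : List (Box w)} {X Y : Word ι} (d : Sequential w l X Y)
    (Z : Word ι) : (d.whiskerRight Z).eval = d.eval ▷ Z.eval w := by
  induction d with
  | nil t => exact t.eval_whiskerRight Z
  | @cons l X Y R b t d ih =>
    rw [whiskerRight, eval, eval_precomp, ih]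
    exact box_whiskerRight _ _ _ _

/-- A string diagram consisting of a single box. -/
def single (b : Box w) : Sequential w [b] b.dom b.cod :=
  cons b (.symm (.rightUnitor _)) (nil (.rightUnitor _))

theorem eval_single (b : Box w) : (single b).eval = b.hom := by
  change (ρ_ _).inv ≫ b.hom ▷ 𝟙_ C ≫ (ρ_ _).hom = _
  simp

/-- A string diagram in sequential form next to further wires on the left. -/
def whiskerLeft (Z : Word ι) : ∀ {l : List (Box w)} {X Y : Word ι},
    Sequential w l X Y → Sequential w l (.tensor Z X) (.tensor Z Y)
  | _, _, _, nil t => nil (t.whiskerLeft Z)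
  | _, _, _, cons b t d => cons b ((t.whiskerLeft Z).trans (.swapFront _ _ _))
      ((d.whiskerLeft Z).precomp (.swapFront _ _ _))

theorem eval_whiskerLeft {l : List (Box w)} {X Y : Word ι} (Z : Word ι)
    (d : Sequential w l X Y) : (d.whiskerLeft Z).eval = Z.eval w ◁ d.eval := by
  induction d with
  | nil t => exact t.eval_whiskerLeft Z
  | cons b t d ih =>
    simp only [whiskerLeft, eval, eval_precomp, ih, FormalIso.eval, Iso.trans_hom,
      FormalIso.eval_whiskerLeft, FormalIso.eval_swapFront]
    exact box_whiskerLeft _ _ _ _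

theorem exists_eval_eq_swap {l : List (Box w)} {b c : Box w} {X Y R S : Word ι}
    (t : FormalIso X (.tensor c.dom S)) (t' : FormalIso (.tensor c.cod S) (.tensor b.dom R))
    (d : Sequential w l (.tensor b.cod R) Y) (hc : (c.cod.toList ++ S.toList).Nodup)
    (hb : b.dom.toList ⊆ S.toList) :
    ∃ (Q : Word ι) (s : FormalIso X (.tensor b.dom Q)) (e : Sequential w (c :: l) _ Y),
      (cons c t (cons b t' d)).eval = (cons b s e).eval := by
  have hb' : b.dom.toList.Nodup :=
    (List.nodup_append'.1 (t'.toList_perm.nodup_iff.1 hc)).1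
  obtain ⟨Q, ⟨p⟩⟩ := FormalIso.exists_tensor_of_subset hb' hb
  obtain ⟨q⟩ : Nonempty (FormalIso (.tensor c.cod Q) R) := FormalIso.nonempty_of_perm <| by
    classical
    have ht' := t'.toList_perm
    have hp := p.toList_perm
    simp only [List.perm_iff_count, Word.toList, List.count_append] at ht' hp ⊢
    intro i
    linarith [ht' i, hp i]
  refine ⟨.tensor c.dom Q, t.trans ((p.whiskerLeft c.dom).trans (.swapFront _ _ _)),
    cons c (.swapFront _ _ _) (d.precomp ((FormalIso.swapFront _ _ _).trans (q.whiskerLeft b.cod))),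
    ?_⟩
  have ht' : (t'.eval w).hom = c.cod.eval w ◁ (p.eval w).hom ≫
      swapFront _ _ _ ≫ b.dom.eval w ◁ (q.eval w).hom := by
    rw [FormalIso.eval_eq (X := .tensor c.cod S) hc t' ((p.whiskerLeft c.cod).trans
      ((FormalIso.swapFront _ _ _).trans (q.whiskerLeft b.dom))) w]
    simp only [FormalIso.eval, Iso.trans_hom, FormalIso.eval_whiskerLeft, FormalIso.eval_swapFront]
    rfl
  simp only [eval, eval_precomp, FormalIso.eval, Iso.trans_hom, ht', FormalIso.eval_whiskerLeft,
    FormalIso.eval_swapFront]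
  exact exchange_of_swapFront _ _ _ _ _ _

theorem exists_eval_eq_cons {l : List (Box w)} {X Y : Word ι} (d : Sequential w l X Y) {b : Box w}
    (hb : b ∈ l) (hbX : b.dom.toList ⊆ X.toList) (hl : (X.toList ++ outputs l).Nodup) :
    ∃ (l' : List (Box w)) (R : Word ι) (t : FormalIso X (.tensor b.dom R))
      (e : Sequential w l' (.tensor b.cod R) Y), l.Perm (b :: l') ∧ d.eval = (cons b t e).eval := by
  induction d with
  | nil => simp at hb
  | @cons l X Y S c t d ih =>
    rcases List.mem_cons.1 hb with rfl | hb
    · exact ⟨l, S, t, d, .refl _, rfl⟩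
    have hcX : (c.dom.toList ++ (c.cod.toList ++ S.toList ++ outputs l)).Nodup :=
      hl.perm <| by
        classical
        have ht := t.toList_perm
        simp only [List.perm_iff_count, outputs, List.flatMap_cons, toList, List.count_append]
          at ht ⊢
        intro i
        linarith [ht i]
    obtain ⟨-, hc, hdisj⟩ := List.nodup_append'.1 hcX
    have hbS : b.dom.toList ⊆ S.toList := by
      intro i hi
      exact (List.mem_append.1 (t.toList_perm.subset (hbX hi))).resolve_left fun hic =>
        hdisj hic (d.mem_of_mem_dom hb hi)
    obtain ⟨l', R, t', e, hl', hd⟩ :=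
      ih hb (List.Subset.trans hbS (List.subset_append_right _ _)) hc
    obtain ⟨Q, s, e', h⟩ := exists_eval_eq_swap t t' e (List.nodup_append'.1 hc).1 hbS
    refine ⟨c :: l', Q, s, e', (hl'.cons c).trans (.swap _ _ _), ?_⟩
    rw [← h, eval, eval, hd]

theorem eval_eq {l l' : List (Box w)} {X Y : Word ι} (d : Sequential w l X Y)
    (e : Sequential w l' X Y) (hl : l.Perm l') (hX : (X.toList ++ outputs l).Nodup) :
    d.eval = e.eval := by
  induction d generalizing l' with
  | nil t =>
    obtain rfl := hl.nil_eq
    cases e with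
    | nil t' =>
      exact congrArg Iso.hom (FormalIso.eval_eq (List.nodup_append'.1 hX).1 t t' w)
  | @cons l X Y R b t d ih =>
    have hR := t.toList_perm
    obtain ⟨l'', R', t', e', hl', he⟩ := e.exists_eval_eq_cons (hl.subset List.mem_cons_self)
      (List.Subset.trans (List.subset_append_left _ _) hR.symm.subset)
      (hX.perm ((hl.flatMap_right _).append_left _))
    obtain ⟨s⟩ : Nonempty (FormalIso R R') :=
      FormalIso.nonempty_of_perm <| (List.perm_append_left_iff _).1 (hR.symm.trans t'.toList_perm)
    have hR' : ((Word.tensor b.cod R).toList ++ outputs l).Nodup := by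
      refine (List.nodup_append'.1 (hX.perm (l' := b.dom.toList ++ _) ?_)).2.1
      classical
      simp only [List.perm_iff_count, outputs, List.flatMap_cons, toList, List.count_append]
        at hR ⊢
      intro i
      linarith [hR i]
    have ht' : (t'.eval w).hom = (t.eval w).hom ≫ b.dom.eval w ◁ (s.eval w).hom := by
      rw [← FormalIso.eval_whiskerLeft]
      exact congrArg Iso.hom
        (FormalIso.eval_eq (List.nodup_append'.1 hX).1 t' (t.trans (s.whiskerLeft _)) w)
    have hd : d.eval = b.cod.eval w ◁ (s.eval w).hom ≫ e'.eval := by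
      rw [ih (e'.precomp (s.whiskerLeft b.cod)) (hl.trans hl').cons_inv hR', eval_precomp,
        FormalIso.eval_whiskerLeft]
      rfl
    rw [he, eval, eval, ht', hd]
    exact box_whisker_exchange _ _ _ _

end Sequential

/-- Recognition of string diagrams: `f` is built from the boxes `l`, and its source and target are
labelled by `X` and `Y`. The objects `A` and `B` are kept apart from the values of the words so that
the constructors can be applied by unification. -/
inductive IsDiagram (w : ι → C) :
    List (Box w) → Word ι → Word ι → ∀ {A B : C}, (A ⟶ B) → Prop
  | box (b : Box w) : IsDiagram w [b] b.dom b.cod b.hom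
  | comp {l l' X Y Z} {A B D : C} {f : A ⟶ B} {g : B ⟶ D} :
      IsDiagram w l X Y f → IsDiagram w l' Y Z g → IsDiagram w (l ++ l') X Z (f ≫ g)
  | tensorHom {l l' X Y X' Y'} {A B A' B' : C} {f : A ⟶ B} {g : A' ⟶ B'} :
      IsDiagram w l X Y f → IsDiagram w l' X' Y' g →
      IsDiagram w (l ++ l') (.tensor X X') (.tensor Y Y') (f ⊗ₘ g)
  | whiskerRight {l X Y Z} {A B D : C} {f : A ⟶ B} :
      IsDiagram w l X Y f → Z.eval w = D → IsDiagram w l (.tensor X Z) (.tensor Y Z) (f ▷ D)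
  | whiskerLeft {l X Y Z} {A B D : C} {f : A ⟶ B} :
      IsDiagram w l X Y f → Z.eval w = D → IsDiagram w l (.tensor Z X) (.tensor Z Y) (D ◁ f)
  | id {X} {A : C} : X.eval w = A → IsDiagram w [] X X (𝟙 A)
  | associator {X Y Z} {A B D : C} : X.eval w = A → Y.eval w = B → Z.eval w = D →
      IsDiagram w [] (.tensor (.tensor X Y) Z) (.tensor X (.tensor Y Z)) (α_ A B D).hom
  | associatorInv {X Y Z} {A B D : C} : X.eval w = A → Y.eval w = B → Z.eval w = D →
      IsDiagram w [] (.tensor X (.tensor Y Z)) (.tensor (.tensor X Y) Z) (α_ A B D).inv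
  | leftUnitor {X} {A : C} : X.eval w = A → IsDiagram w [] (.tensor unit X) X (λ_ A).hom
  | leftUnitorInv {X} {A : C} : X.eval w = A → IsDiagram w [] X (.tensor unit X) (λ_ A).inv
  | rightUnitor {X} {A : C} : X.eval w = A → IsDiagram w [] (.tensor X unit) X (ρ_ A).hom
  | rightUnitorInv {X} {A : C} : X.eval w = A → IsDiagram w [] X (.tensor X unit) (ρ_ A).inv
  | braiding {X Y} {A B : C} : X.eval w = A → Y.eval w = B →
      IsDiagram w [] (.tensor X Y) (.tensor Y X) (β_ A B).hom

theorem IsDiagram.exists_sequential {l : List (Box w)} {X Y : Word ι} {A B : C} {f : A ⟶ B}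
    (hf : IsDiagram w l X Y f) :
    X.eval w = A ∧ Y.eval w = B ∧ ∃ d : Sequential w l X Y, HEq d.eval f := by
  induction hf with
  | box b => exact ⟨rfl, rfl, .single b, heq_of_eq (Sequential.eval_single b)⟩
  | comp _ _ ihf ihg =>
    obtain ⟨rfl, rfl, d, ⟨⟩⟩ := ihf
    obtain ⟨_, rfl, e, ⟨⟩⟩ := ihg
    exact ⟨rfl, rfl, e.comp d, heq_of_eq (d.eval_comp e)⟩
  | @tensorHom _ _ _ Y X' _ _ _ _ _ _ _ _ _ ihf ihg =>
    obtain ⟨rfl, rfl, d, ⟨⟩⟩ := ihf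
    obtain ⟨rfl, rfl, e, ⟨⟩⟩ := ihg
    refine ⟨rfl, rfl, (e.whiskerLeft Y).comp (d.whiskerRight X'), heq_of_eq ?_⟩
    rw [Sequential.eval_comp, Sequential.eval_whiskerRight, Sequential.eval_whiskerLeft]
    exact (MonoidalCategory.tensorHom_def _ _).symm
  | whiskerRight _ h ih =>
    obtain ⟨rfl, rfl, d, ⟨⟩⟩ := ih
    subst h
    exact ⟨rfl, rfl, d.whiskerRight _, heq_of_eq (d.eval_whiskerRight _)⟩
  | whiskerLeft _ h ih =>
    obtain ⟨rfl, rfl, d, ⟨⟩⟩ := ih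
    subst h
    exact ⟨rfl, rfl, d.whiskerLeft _, heq_of_eq (d.eval_whiskerLeft _)⟩
  | id h => subst h; exact ⟨rfl, rfl, .nil (.refl _), .rfl⟩
  | associator h h' h'' => subst h h' h''; exact ⟨rfl, rfl, .nil (.associator _ _ _), .rfl⟩
  | associatorInv h h' h'' =>
    subst h h' h''; exact ⟨rfl, rfl, .nil (.symm (.associator _ _ _)), .rfl⟩
  | leftUnitor h => subst h; exact ⟨rfl, rfl, .nil (.leftUnitor _), .rfl⟩
  | leftUnitorInv h => subst h; exact ⟨rfl, rfl, .nil (.symm (.leftUnitor _)), .rfl⟩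
  | rightUnitor h => subst h; exact ⟨rfl, rfl, .nil (.rightUnitor _), .rfl⟩
  | rightUnitorInv h => subst h; exact ⟨rfl, rfl, .nil (.symm (.rightUnitor _)), .rfl⟩
  | braiding h h' => subst h h'; exact ⟨rfl, rfl, .nil (.braiding _ _), .rfl⟩

/-- The valuation of the wires `0, 1, 2, …` by a finite list of objects. -/
def valuation (L : List C) : ℕ → C := fun n => L.getD n (𝟙_ C)

theorem IsDiagram.of (L : List C) (X Y : Word ℕ)
    (f : X.eval (valuation L) ⟶ Y.eval (valuation L)) :
    IsDiagram (valuation L) [⟨X, Y, f⟩] X Y f :=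
  .box ⟨X, Y, f⟩

/-- The boxes that occur in the diagrams are looked up in the local context, by default. -/
theorem diagram_eq (L : List C) (X Y : Word ℕ) {A B : C} {f g : A ⟶ B}
    {l l' : List (Box (valuation L))}
    (hf : IsDiagram (valuation L) l X Y f := by repeat' first | rfl | assumption | constructor)
    (hg : IsDiagram (valuation L) l' X Y g := by repeat' first | rfl | assumption | constructor)
    (hl : l.Perm l' := by
      first
        | exact List.Perm.refl _
        | exact Multiset.coe_eq_coe.1 (by simp only [← Multiset.coe_add, Multiset.coe_nil]; abel))
    (hX : (X.toList ++ outputs l).Nodup := by exact of_decide_eq_true rfl) : f = g := by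
  obtain ⟨rfl, rfl, d, ⟨⟩⟩ := hf.exists_sequential
  obtain ⟨_, _, e, ⟨⟩⟩ := hg.exists_sequential
  exact d.eval_eq e hl hX

end Diagrams

/-- Numerals stand for wires in concrete diagrams. -/
instance (n : ℕ) : OfNat (Word ℕ) n := ⟨wire n⟩

end Wiring

section IntConstruction

open Wiring PartialTrace

local infixr:70 "⬝" => Wiring.Word.tensor

variable {C : Type u} [Category.{v} C] [MonoidalCategory C] [SymmetricCategory C]

/-! ### Feedback -/

theorem eq_some_of_some_le {α : Type*} {a : α} {x : Part α} (h : Part.some a ≤ x) :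
    x = Part.some a :=
  Part.eq_some_iff.2 (h a (Part.mem_some a))

namespace PartialTrace

variable (T : PartialTrace C)

theorem tr_comp {A B A' B' U : C} {f : A ⊗ U ⟶ B ⊗ U} {t : A ⟶ B} (h : T.tr U f = Part.some t)
    (g : A' ⟶ A) (k : B ⟶ B') :
    T.tr U (g ▷ U ≫ f ≫ k ▷ U) = Part.some (g ≫ t ≫ k) := by
  have := T.naturality f g k
  rw [h, Part.map_some] at this
  exact eq_some_of_some_le this

theorem tr_whiskerLeft {A B U : C} {f : A ⊗ U ⟶ B ⊗ U} {t : A ⟶ B} (h : T.tr U f = Part.some t)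
    (R : C) :
    T.tr U ((α_ R A U).hom ≫ R ◁ f ≫ (α_ R B U).inv) = Part.some (R ◁ t) := by
  have := T.strength f (𝟙 R)
  rw [h, Part.map_some] at this
  simpa only [id_tensorHom] using eq_some_of_some_le this

/-- The composite of `a` and `b` with the wire `U` between them led around the loop. -/
def compViaLoop {X Y Z U : C} (a : X ⟶ Y ⊗ U) (b : Y ⊗ U ⟶ Z) : X ⊗ U ⟶ Z ⊗ U :=
  a ▷ U ≫ ((α_ Y U U).hom ≫ Y ◁ (β_ U U).hom ≫ (α_ Y U U).inv) ≫ b ▷ U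

theorem tr_compViaLoop {X Y Z U : C} (a : X ⟶ Y ⊗ U) (b : Y ⊗ U ⟶ Z) :
    T.tr U (compViaLoop a b) = Part.some (a ≫ b) := by
  simpa [compViaLoop] using T.tr_comp (T.tr_whiskerLeft (T.yanking U) Y) a b

/-- A morphism as a morphism with feedback along the unit. -/
def trivialLoop {X Y : C} (f : X ⟶ Y) : X ⊗ 𝟙_ C ⟶ Y ⊗ 𝟙_ C := f ▷ 𝟙_ C

theorem tr_trivialLoop {X Y : C} (f : X ⟶ Y) : T.tr (𝟙_ C) (trivialLoop f) = Part.some f := by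
  rw [T.vanishing_one]
  simp [trivialLoop]

/-- Equality up to sliding along the feedback wires and evaluation of partial traces. -/
inductive LoopEq {X Y : C} : ∀ {U V : C}, (X ⊗ U ⟶ Y ⊗ U) → (X ⊗ V ⟶ Y ⊗ V) → Prop
  | symm {U V : C} {f : X ⊗ U ⟶ Y ⊗ U} {g : X ⊗ V ⟶ Y ⊗ V} : LoopEq f g → LoopEq g f
  | trans {U V W : C} {f : X ⊗ U ⟶ Y ⊗ U} {g : X ⊗ V ⟶ Y ⊗ V} {h : X ⊗ W ⟶ Y ⊗ W} :
      LoopEq f g → LoopEq g h → LoopEq f h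
  | slide {U V : C} (f : X ⊗ U ⟶ Y ⊗ V) (g : V ⟶ U) : LoopEq (f ≫ Y ◁ g) (X ◁ g ≫ f)
  | tr {U V : C} (f : (X ⊗ U) ⊗ V ⟶ (Y ⊗ U) ⊗ V) (g : X ⊗ U ⟶ Y ⊗ U) :
      T.tr V f = Part.some g → LoopEq ((α_ X U V).inv ≫ f ≫ (α_ Y U V).hom) g

variable {T}

theorem LoopEq.tr_eq {X Y U V : C} {f : X ⊗ U ⟶ Y ⊗ U} {g : X ⊗ V ⟶ Y ⊗ V} (h : T.LoopEq f g) :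
    T.tr U f = T.tr V g := by
  induction h with
  | symm _ ih => exact ih.symm
  | trans _ _ ih ih' => exact ih.trans ih'
  | slide f g => exact T.dinaturality f g
  | @tr U V f g h =>
    obtain ⟨hd, hg⟩ := Part.eq_some_iff.1 h
    rw [← T.vanishing_two f hd, hg]

theorem LoopEq.of_iso {X Y U V : C} {f : X ⊗ U ⟶ Y ⊗ U} {g : X ⊗ V ⟶ Y ⊗ V} (e : U ≅ V)
    (h : f ≫ Y ◁ e.hom = X ◁ e.hom ≫ g) : T.LoopEq f g := by
  have := LoopEq.slide (T := T) (g ≫ Y ◁ e.inv) e.hom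
  rw [← reassoc_of% h] at this
  simpa using this.symm

theorem LoopEq.refl {X Y U : C} (f : X ⊗ U ⟶ Y ⊗ U) : T.LoopEq f f :=
  .of_iso (Iso.refl U) (by simp)

theorem loopEq_trivialLoop {X Y U : C} {f : X ⊗ U ⟶ Y ⊗ U} {g : X ⟶ Y}
    (h : T.tr U f = Part.some g) :
    T.LoopEq f (trivialLoop g) := by
  have h₁ : T.tr U ((ρ_ X).hom ▷ U ≫ f ≫ (ρ_ Y).inv ▷ U) = Part.some (trivialLoop g) := by
    rw [T.tr_comp h]
    simp [trivialLoop]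
  refine .trans (.of_iso (λ_ U).symm ?_) (.tr _ _ h₁)
  simp

theorem LoopEq.tr_eq_some {X Y U : C} {f : X ⊗ U ⟶ Y ⊗ U} {g : X ⟶ Y}
    (h : T.LoopEq f (trivialLoop g)) :
    T.tr U f = Part.some g :=
  h.tr_eq.trans (T.tr_trivialLoop g)

/-- The morphism `m` in a context: it is preceded by `a` and followed by `b`, which use a further
feedback wire `E`, and a wire `R` passes by `m`. -/
def inContext {X Y X' Y' E R U V : C} (a : X' ⊗ E ⟶ X ⊗ R) (b : Y ⊗ R ⟶ Y' ⊗ E)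
    (m : X ⊗ U ⟶ Y ⊗ V) : X' ⊗ (U ⊗ E) ⟶ Y' ⊗ (V ⊗ E) :=
  X' ◁ (β_ U E).hom ≫ (α_ X' E U).inv ≫ a ▷ U ≫ (α_ X R U).hom ≫ X ◁ (β_ R U).hom ≫
    (α_ X U R).inv ≫ m ▷ R ≫ (α_ Y V R).hom ≫ Y ◁ (β_ V R).hom ≫ (α_ Y R V).inv ≫ b ▷ V ≫
    (α_ Y' E V).hom ≫ Y' ◁ (β_ E V).hom

theorem inContext_comp {X Y X' Y' E R U V W : C} (a : X' ⊗ E ⟶ X ⊗ R) (b : Y ⊗ R ⟶ Y' ⊗ E)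
    (m : X ⊗ U ⟶ Y ⊗ V) (g : V ⟶ W) :
    inContext a b (m ≫ Y ◁ g) = inContext a b m ≫ Y' ◁ (g ▷ E) := by
  let L := [X', E, U, X, R, Y, V, Y', E, W]
  have := IsDiagram.of L (0⬝1) (3⬝4) a
  have := IsDiagram.of L (5⬝4) (7⬝8) b
  have := IsDiagram.of L (3⬝2) (5⬝6) m
  have := IsDiagram.of L 6 9 g
  exact diagram_eq L (0⬝2⬝1) (7⬝9⬝8)

theorem comp_inContext {X Y X' Y' E R U V W : C} (a : X' ⊗ E ⟶ X ⊗ R) (b : Y ⊗ R ⟶ Y' ⊗ E)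
    (m : X ⊗ U ⟶ Y ⊗ V) (g : W ⟶ U) :
    inContext a b (X ◁ g ≫ m) = X' ◁ (g ▷ E) ≫ inContext a b m := by
  let L := [X', E, U, X, R, Y, V, Y', E, W]
  have := IsDiagram.of L (0⬝1) (3⬝4) a
  have := IsDiagram.of L (5⬝4) (7⬝8) b
  have := IsDiagram.of L (3⬝2) (5⬝6) m
  have := IsDiagram.of L 9 2 g
  exact diagram_eq L (0⬝9⬝1) (7⬝6⬝8)

theorem loopEq_inContext_of_tr_eq_some {X Y X' Y' E R U V : C} (a : X' ⊗ E ⟶ X ⊗ R)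
    (b : Y ⊗ R ⟶ Y' ⊗ E) {f : (X ⊗ U) ⊗ V ⟶ (Y ⊗ U) ⊗ V} {g : X ⊗ U ⟶ Y ⊗ U}
    (h : T.tr V f = Part.some g) :
    T.LoopEq (inContext a b ((α_ X U V).inv ≫ f ≫ (α_ Y U V).hom)) (inContext a b g) := by
  let P : X' ⊗ (U ⊗ E) ⟶ R ⊗ (X ⊗ U) :=
    X' ◁ (β_ U E).hom ≫ (α_ X' E U).inv ≫ a ▷ U ≫ (β_ X R).hom ▷ U ≫ (α_ R X U).hom
  let Q : R ⊗ (Y ⊗ U) ⟶ Y' ⊗ (U ⊗ E) :=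
    (α_ R Y U).inv ≫ (β_ R Y).hom ▷ U ≫ b ▷ U ≫ (α_ Y' E U).hom ≫ Y' ◁ (β_ E U).hom
  have hg : P ≫ R ◁ g ≫ Q = inContext a b g := by
    let L := [X', E, U, X, R, Y, U, Y', E]
    have := IsDiagram.of L (0⬝1) (3⬝4) a
    have := IsDiagram.of L (5⬝4) (7⬝8) b
    have := IsDiagram.of L (3⬝2) (5⬝6) g
    exact diagram_eq L (0⬝2⬝1) (7⬝6⬝8)
  have ht := T.tr_comp (T.tr_whiskerLeft h R) P Q
  rw [hg] at ht
  refine .trans (.of_iso (α_ U V E ≪≫ whiskerLeftIso U (β_ V E) ≪≫ (α_ U E V).symm) ?_)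
    (.tr _ _ ht)
  let L := [X', E, U, X, R, Y, U, Y', E, V, V]
  have := IsDiagram.of L (0⬝1) (3⬝4) a
  have := IsDiagram.of L (5⬝4) (7⬝8) b
  have := IsDiagram.of L ((3⬝2)⬝9) ((5⬝6)⬝10) f
  exact diagram_eq L (0⬝(2⬝9)⬝1) (7⬝(6⬝8)⬝10)

theorem LoopEq.inContext {X Y X' Y' E R U V : C} (a : X' ⊗ E ⟶ X ⊗ R) (b : Y ⊗ R ⟶ Y' ⊗ E)
    {f : X ⊗ U ⟶ Y ⊗ U} {g : X ⊗ V ⟶ Y ⊗ V} (h : T.LoopEq f g) :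
    T.LoopEq (PartialTrace.inContext a b f) (PartialTrace.inContext a b g) := by
  induction h with
  | symm _ ih => exact ih.symm
  | trans _ _ ih ih' => exact ih.trans ih'
  | slide f g =>
    rw [inContext_comp, comp_inContext]
    exact .slide _ _
  | tr _ _ h => exact loopEq_inContext_of_tr_eq_some a b h

end PartialTrace

/-! ### Composition of paths in the partial Int-construction -/

section Composition

/-- The exchange of the last two of three factors. -/
def swapBack (A B D : C) : (A ⊗ B) ⊗ D ⟶ (A ⊗ D) ⊗ B :=
  (α_ A B D).hom ≫ A ◁ (β_ B D).hom ≫ (α_ A D B).inv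

namespace IntObj

/-- Arrows `A ⟶ B` of the partial Int-construction with a further wire to be fed back, of type `U`
at the input and `V` at the output. -/
abbrev LoopHom (A B : IntObj C) (U V : C) : Type v :=
  (A.pos ⊗ B.neg) ⊗ U ⟶ (B.pos ⊗ A.neg) ⊗ V

/-- The morphism whose trace is the composition of the path. -/
def loop {A B : IntObj C} (p : Quiver.Path A B) : LoopHom A B (vec p) (vec p) :=
  (α_ A.pos B.neg (vec p)).hom ≫ A.pos ◁ (β_ B.neg (vec p)).hom ≫ precomp p ≫
    (α_ B.pos A.neg (vec p)).inv

/-- Postcomposition with an arrow `e : B ⟶ D`, the wire `B⁻` being fed back. -/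
def postcomp {A B D : IntObj C} {U V : C} (m : LoopHom A B U V) (e : B ⟶ D) :
    LoopHom A D (U ⊗ B.neg) (V ⊗ B.neg) :=
  inContext (swapBack A.pos D.neg B.neg)
    (swapBack B.pos A.neg D.neg ≫ mor e ▷ A.neg ≫ swapBack D.pos B.neg A.neg) m

/-- Composition of arrows with feedback, the wire `B⁻` between them being fed back too. -/
def loopComp {A B D : IntObj C} {U W W' : C} (m : LoopHom A B U U) (n : LoopHom B D W W') :
    LoopHom A D (W ⊗ (U ⊗ B.neg)) (W' ⊗ (U ⊗ B.neg)) :=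
  inContext (E := U ⊗ B.neg) (R := A.neg ⊗ U)
    (swapBack _ _ _ ≫ (A.pos ◁ (β_ U B.neg).hom) ▷ _ ≫ (α_ _ _ _).inv ▷ _ ≫ m ▷ D.neg ≫
      (α_ _ _ _).hom ▷ _ ≫ swapBack _ _ _)
    (swapBack _ _ _ ≫ (α_ _ _ _).inv ▷ _ ≫ (α_ _ _ _).hom) n

theorem loop_nil (A : IntObj C) : loop (.nil : Quiver.Path A A) = 𝟙 _ := by
  exact diagram_eq [A.pos, A.neg] ((0⬝1)⬝.unit) ((0⬝1)⬝.unit)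

theorem loop_cons {A B D : IntObj C} (p : Quiver.Path A B) (e : B ⟶ D) :
    loop (p.cons e) = postcomp (loop p) e := by
  let L := [A.pos, vec p, B.neg, B.pos, A.neg, vec p, D.neg, D.pos, B.neg]
  have := IsDiagram.of L (0⬝1⬝2) (3⬝4⬝5) (precomp p)
  have := IsDiagram.of L (3⬝6) (7⬝8) (mor e)
  exact diagram_eq L ((0⬝6)⬝1⬝2) ((7⬝4)⬝5⬝8)

variable {T : PartialTrace C}

theorem loopEq_postcomp_loopComp {A B D : IntObj C} {U : C} (m : LoopHom A B U U) (h : B ⟶ D) :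
    T.LoopEq (postcomp m h) (loopComp m (trivialLoop (mor h))) := by
  refine .of_iso (λ_ _).symm ?_
  let L := [A.pos, B.neg, U, B.pos, A.neg, U, D.neg, D.pos, B.neg]
  have := IsDiagram.of L ((0⬝1)⬝2) ((3⬝4)⬝5) m
  have := IsDiagram.of L (3⬝6) (7⬝8) (mor h)
  exact diagram_eq L ((0⬝6)⬝2⬝1) ((7⬝4)⬝.unit⬝5⬝8)

theorem loopEq_loopComp_postcomp {A B D E : IntObj C} {U W : C} (m : LoopHom A B U U)
    (n : LoopHom B D W W) (e : D ⟶ E) :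
    T.LoopEq (loopComp m (postcomp n e)) (postcomp (loopComp m n) e) := by
  refine .of_iso (α_ _ _ _ ≪≫ whiskerLeftIso _ (β_ _ _) ≪≫ (α_ _ _ _).symm) ?_
  let L := [A.pos, B.neg, U, B.pos, A.neg, U, D.neg, W, D.pos, B.neg, W, E.neg, E.pos, D.neg]
  have := IsDiagram.of L ((0⬝1)⬝2) ((3⬝4)⬝5) m
  have := IsDiagram.of L ((3⬝6)⬝7) ((8⬝9)⬝10) n
  have := IsDiagram.of L (8⬝11) (12⬝13) (mor e)
  exact diagram_eq L ((0⬝11)⬝(7⬝6)⬝2⬝1) ((12⬝4)⬝(10⬝5⬝9)⬝13)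

theorem loopEq_loopComp_id {A B : IntObj C} {U : C} (m : LoopHom A B U U) :
    T.LoopEq (loopComp m (𝟙 ((B.pos ⊗ B.neg) ⊗ 𝟙_ C))) m := by
  have h := T.tr_compViaLoop (swapBack A.pos B.neg U) (swapBack A.pos U B.neg ≫ m)
  have h' : swapBack A.pos B.neg U ≫ swapBack A.pos U B.neg ≫ m = m := by
    let L := [A.pos, B.neg, U, B.pos, A.neg, U]
    have := IsDiagram.of L ((0⬝1)⬝2) ((3⬝4)⬝5) m
    exact diagram_eq L ((0⬝1)⬝2) ((3⬝4)⬝5)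
  rw [h'] at h
  refine .trans (.of_iso (λ_ _) ?_) (.tr _ _ h)
  let L := [A.pos, B.neg, U, B.pos, A.neg, U, B.neg]
  have := IsDiagram.of L ((0⬝1)⬝2) ((3⬝4)⬝5) m
  exact diagram_eq L ((0⬝6)⬝.unit⬝2⬝1) ((3⬝4)⬝5⬝6)

theorem loopEq_postcomp {A B D : IntObj C} {U V : C} {m : LoopHom A B U U} {n : LoopHom A B V V}
    (h : T.LoopEq m n) (e : B ⟶ D) : T.LoopEq (postcomp m e) (postcomp n e) :=
  h.inContext _ _

theorem loopEq_loopComp_loop {A B D : IntObj C} (p : Quiver.Path A B) (q : Quiver.Path B D) :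
    T.LoopEq (loopComp (loop p) (loop q)) (loop (p.comp q)) := by
  induction q with
  | nil =>
    rw [loop_nil]
    exact loopEq_loopComp_id (loop p)
  | cons q e ih =>
    rw [Quiver.Path.comp_cons, loop_cons, loop_cons]
    exact (loopEq_loopComp_postcomp (loop p) (loop q) e).trans (loopEq_postcomp ih e)

theorem loopEq_loop_comp {A B D : IntObj C} {p q : Quiver.Path A B}
    (h : T.LoopEq (loop p) (loop q)) (s : Quiver.Path B D) :
    T.LoopEq (loop (p.comp s)) (loop (q.comp s)) := by
  induction s with
  | nil => exact h
  | cons s e ih =>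
    rw [Quiver.Path.comp_cons, Quiver.Path.comp_cons, loop_cons, loop_cons]
    exact loopEq_postcomp ih e

theorem loopEq_loop_toPath {A B : IntObj C} (f : A ⟶ B) :
    T.LoopEq (loop f.toPath) (trivialLoop (mor f)) := by
  change T.LoopEq (loop (Quiver.Path.nil.cons f)) (trivialLoop (mor f))
  rw [loop_cons, loop_nil]
  have h : T.tr A.neg (compViaLoop (mor f) (𝟙 _)) = Part.some (mor f) := by
    simpa using T.tr_compViaLoop (mor f) (𝟙 _)
  refine .trans (.of_iso (λ_ _) ?_) (loopEq_trivialLoop h)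
  let L := [A.pos, B.neg, B.pos, A.neg, A.neg]
  have := IsDiagram.of L (0⬝1) (2⬝3) (mor f)
  exact diagram_eq L ((0⬝1)⬝.unit⬝4) ((2⬝4)⬝3)

variable (T)

theorem pathComp_nil (A : IntObj C) :
    pathComp T (.nil : Quiver.Path A A) = Part.some (𝟙 (A.pos ⊗ A.neg)) := by
  change T.tr (𝟙_ C) (loop (.nil : Quiver.Path A A)) = _
  rw [loop_nil, ← T.tr_trivialLoop (𝟙 (A.pos ⊗ A.neg)), trivialLoop, id_whiskerRight]
  rfl

theorem pathComp_toPath {A B : IntObj C} (f : A ⟶ B) : pathComp T f.toPath = Part.some f :=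
  (loopEq_loop_toPath f).tr_eq_some

variable {T}

-- The loop of the composite path contains the loop of `f`, which may be traced out first.
theorem pathComp_comp_toPath_comp {A B D E : IntObj C} (r : Quiver.Path A B) {f : Quiver.Path B D}
    {h : B ⟶ D} (hf : pathComp T f = Part.some h) (s : Quiver.Path D E) :
    pathComp T ((r.comp h.toPath).comp s) = pathComp T ((r.comp f).comp s) := by
  refine (loopEq_loop_comp ?_ s).tr_eq
  change T.LoopEq (loop (r.cons h)) _
  rw [loop_cons]
  have hf' : T.LoopEq (trivialLoop (mor h)) (loop f) := (loopEq_trivialLoop hf).symm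
  exact (loopEq_postcomp_loopComp (loop r) h).trans
    ((hf'.inContext _ _).trans (loopEq_loopComp_loop r f))

end IntObj

theorem intPara_isParacategory (T : PartialTrace C) : (intPara T).IsParacategory where
  comp_nil_dom A := by
    change (IntObj.pathComp T _).Dom
    rw [IntObj.pathComp_nil]
    trivial
  comp_toPath f := IntObj.pathComp_toPath T f
  comp_comp r _ s h := IntObj.pathComp_comp_toPath_comp r (Part.some_get h).symm s

end Composition

/-! ### Functoriality of the tensor product -/

section Tensor

/-- The middle-four interchange. -/
def interchange (A B D E : C) : (A ⊗ B) ⊗ (D ⊗ E) ≅ (A ⊗ D) ⊗ (B ⊗ E) where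
  hom := tensorμ A B D E
  inv := tensorδ A B D E

namespace IntObj

/-- The input side of the tensor product of arrows. -/
def tensorSource (A B E D : C) : (A ⊗ B) ⊗ (E ⊗ D) ⟶ (A ⊗ D) ⊗ (B ⊗ E) :=
  (α_ A B (E ⊗ D)).hom ≫ A ◁ (α_ B E D).inv ≫ A ◁ (β_ (B ⊗ E) D).hom ≫ (α_ A D (B ⊗ E)).inv

/-- The output side of the tensor product of arrows. -/
def tensorTarget (D A E B : C) : (D ⊗ A) ⊗ (E ⊗ B) ⟶ (D ⊗ E) ⊗ (B ⊗ A) :=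
  (α_ D A (E ⊗ B)).hom ≫ D ◁ (β_ A (E ⊗ B)).hom ≫ D ◁ (α_ E B A).hom ≫ (α_ D E (B ⊗ A)).inv

variable {A B D E : IntObj C} {U W : C}

/-- The tensor product of arrows with feedback, as a context of the first factor. -/
def loopTensorLeft (m : LoopHom A D U U) (n : LoopHom B E W W) :
    LoopHom (tens A B) (tens D E) (U ⊗ W) (U ⊗ W) :=
  inContext (tensorSource _ _ _ _ ▷ W ≫ (α_ _ _ _).hom)
    (_ ◁ n ≫ (α_ _ _ _).inv ≫ tensorTarget _ _ _ _ ▷ W) m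

/-- The tensor product of arrows with feedback, as a context of the second factor. -/
def loopTensorRight (m : LoopHom A D U U) (n : LoopHom B E W W) :
    LoopHom (tens A B) (tens D E) (W ⊗ U) (W ⊗ U) :=
  inContext (tensorSource _ _ _ _ ▷ U ≫ (β_ _ _).hom ▷ U ≫ (α_ _ _ _).hom)
    (_ ◁ m ≫ (α_ _ _ _).inv ≫ (β_ _ _).hom ▷ U ≫ tensorTarget _ _ _ _ ▷ U) n

variable {T : PartialTrace C}

theorem loopEq_loopTensorLeft_loopTensorRight (m : LoopHom A D U U) (n : LoopHom B E W W) :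
    T.LoopEq (loopTensorLeft m n) (loopTensorRight m n) := by
  refine .of_iso (β_ _ _) ?_
  let L := [A.pos, D.neg, U, D.pos, A.neg, U, B.pos, E.neg, W, E.pos, B.neg, W]
  have := IsDiagram.of L ((0⬝1)⬝2) ((3⬝4)⬝5) m
  have := IsDiagram.of L ((6⬝7)⬝8) ((9⬝10)⬝11) n
  exact diagram_eq L (((0⬝6)⬝7⬝1)⬝2⬝8) (((3⬝9)⬝10⬝4)⬝11⬝5)

theorem loopEq_loopTensorRight_trivialLoop (f : A ⟶ D) (g : B ⟶ E) :
    T.LoopEq (loopTensorRight (trivialLoop (mor f)) (trivialLoop (mor g)))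
      (trivialLoop (mor (tensHom f g))) := by
  refine .of_iso (λ_ _) ?_
  let L := [A.pos, D.neg, D.pos, A.neg, B.pos, E.neg, E.pos, B.neg]
  have := IsDiagram.of L (0⬝1) (2⬝3) (mor f)
  have := IsDiagram.of L (4⬝5) (6⬝7) (mor g)
  exact diagram_eq L (((0⬝4)⬝5⬝1)⬝.unit⬝.unit) (((2⬝6)⬝7⬝3)⬝.unit)

-- The tensor product is a context of either factor, so the two loops can be replaced in turn.
theorem loopEq_loopTensorLeft {m : LoopHom A D U U} {n : LoopHom B E W W} {f : A ⟶ D} {g : B ⟶ E}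
    (hf : T.LoopEq m (trivialLoop (mor f))) (hg : T.LoopEq n (trivialLoop (mor g))) :
    T.LoopEq (loopTensorLeft m n) (trivialLoop (mor (tensHom f g))) :=
  .trans (hf.inContext _ _) (.trans (loopEq_loopTensorLeft_loopTensorRight _ _)
    (.trans (hg.inContext _ _) (loopEq_loopTensorRight_trivialLoop f g)))

theorem loopEq_postcomp_loopTensorLeft {D' E' : IntObj C} (m : LoopHom A D U U)
    (n : LoopHom B E W W) (f : D ⟶ D') (g : E ⟶ E') :
    T.LoopEq (postcomp (B := tens D E) (loopTensorLeft m n) (tensHom f g))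
      (loopTensorLeft (postcomp m f) (postcomp n g)) := by
  refine .of_iso (whiskerLeftIso (U ⊗ W) (β_ E.neg D.neg) ≪≫ interchange U W D.neg E.neg) ?_
  let L := [A.pos, D.neg, U, D.pos, A.neg, U, B.pos, E.neg, W, E.pos, B.neg, W,
    D'.neg, D'.pos, D.neg, E'.neg, E'.pos, E.neg]
  have := IsDiagram.of L ((0⬝1)⬝2) ((3⬝4)⬝5) m
  have := IsDiagram.of L ((6⬝7)⬝8) ((9⬝10)⬝11) n
  have := IsDiagram.of L (3⬝12) (13⬝14) (mor f)
  have := IsDiagram.of L (9⬝15) (16⬝17) (mor g)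
  exact diagram_eq L (((0⬝6)⬝15⬝12)⬝(2⬝8)⬝7⬝1) (((13⬝16)⬝10⬝4)⬝(5⬝14)⬝11⬝17)

theorem loopEq_id_loopTensorLeft (A B : IntObj C) :
    T.LoopEq (𝟙 (((A.pos ⊗ B.pos) ⊗ (B.neg ⊗ A.neg)) ⊗ 𝟙_ C))
      (loopTensorLeft (𝟙 ((A.pos ⊗ A.neg) ⊗ 𝟙_ C)) (𝟙 ((B.pos ⊗ B.neg) ⊗ 𝟙_ C))) := by
  refine .of_iso (λ_ (𝟙_ C)).symm ?_
  exact diagram_eq [A.pos, A.neg, B.pos, B.neg] (((0⬝2)⬝3⬝1)⬝.unit) (((0⬝2)⬝3⬝1)⬝.unit⬝.unit)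

variable (T)

/-- The first components of a path in the product graph. -/
def fstPath {X Y : ((intPara T).prod (intPara T)).Obj} (p : Quiver.Path X Y) :
    Quiver.Path X.1 Y.1 :=
  letI := ParaData.prodQuiver (intPara T) (intPara T)
  (ParaData.fst (intPara T) (intPara T)).mapPath p

/-- The second components of a path in the product graph. -/
def sndPath {X Y : ((intPara T).prod (intPara T)).Obj} (p : Quiver.Path X Y) :
    Quiver.Path X.2 Y.2 :=
  letI := ParaData.prodQuiver (intPara T) (intPara T)
  (ParaData.snd (intPara T) (intPara T)).mapPath p

/-- The tensor product of the arrows of a path in the product graph. -/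
def tensorPath {X Y : ((intPara T).prod (intPara T)).Obj} (p : Quiver.Path X Y) :
    Quiver.Path (tens X.1 X.2) (tens Y.1 Y.2) :=
  (intSymMon T).tensor.mapPath p

theorem loopEq_loop_tensorPath {X Y : ((intPara T).prod (intPara T)).Obj} (p : Quiver.Path X Y) :
    T.LoopEq (loop (tensorPath T p))
      (loopTensorLeft (loop (fstPath T p)) (loop (sndPath T p))) := by
  induction p with
  | nil =>
    have h₁ : loop (fstPath T (.nil : Quiver.Path X X)) = 𝟙 _ := loop_nil X.1
    have h₂ : loop (sndPath T (.nil : Quiver.Path X X)) = 𝟙 _ := loop_nil X.2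
    have h₃ : loop (tensorPath T (.nil : Quiver.Path X X)) = 𝟙 _ := loop_nil (tens X.1 X.2)
    rw [h₁, h₂, h₃]
    exact loopEq_id_loopTensorLeft X.1 X.2
  | cons p e ih =>
    have h := (loopEq_postcomp ih (tensHom e.1 e.2)).trans
      (loopEq_postcomp_loopTensorLeft _ _ e.1 e.2)
    rw [← loop_cons, ← loop_cons, ← loop_cons] at h
    exact h

end IntObj

open IntObj in
theorem intSymMon_tensor_isFunctor (T : PartialTrace C) :
    ParaData.IsFunctor (P := (intPara T).prod (intPara T)) (Q := intPara T)
      (intSymMon T).tensor := by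
  intro X Y p h hh
  change h ∈ Part.map _ ((pathComp T (fstPath T p)).bind fun f =>
    (pathComp T (sndPath T p)).map fun g => (f, g)) at hh
  change h ∈ pathComp T (tensorPath T p)
  obtain ⟨_, hfg, rfl⟩ := (Part.mem_map_iff _).1 hh
  obtain ⟨f, hf, hfg⟩ := Part.mem_bind_iff.1 hfg
  obtain ⟨g, hg, rfl⟩ := (Part.mem_map_iff _).1 hfg
  rw [← Part.eq_some_iff] at hf hg ⊢
  exact ((loopEq_loop_tensorPath T p).trans
    (loopEq_loopTensorLeft (loopEq_trivialLoop hf) (loopEq_trivialLoop hg))).tr_eq_some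

end Tensor

/-! ### Compositions that are always defined -/

section Totality

namespace PartialTrace

/-- The composite of `a`, `f` and `b` with the wires `P` and `Q` between them led around the
loop. -/
def compViaTwoLoops {X Y Z W P Q : C} (a : X ⟶ Y ⊗ P) (f : Y ⊗ P ⟶ Z ⊗ Q) (b : Z ⊗ Q ⟶ W) :
    X ⊗ (P ⊗ Q) ⟶ W ⊗ (P ⊗ Q) :=
  (α_ X P Q).inv ≫
    compViaLoop (a ▷ P ≫ swapBack Y P P ≫ f ▷ P ≫ swapBack Z Q P) (swapBack Z P Q ≫ b ▷ P) ≫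
    (α_ W P Q).hom

theorem tr_compViaTwoLoops (T : PartialTrace C) {X Y Z W P Q : C} (a : X ⟶ Y ⊗ P)
    (f : Y ⊗ P ⟶ Z ⊗ Q) (b : Z ⊗ Q ⟶ W) :
    T.tr (P ⊗ Q) (compViaTwoLoops a f b) = Part.some (a ≫ f ≫ b) := by
  have h : (a ▷ P ≫ swapBack Y P P ≫ f ▷ P ≫ swapBack Z Q P) ≫ swapBack Z P Q ≫ b ▷ P =
      compViaLoop a (f ≫ b) := by
    let L := [X, Y, P, Z, Q, W, P]
    have := IsDiagram.of L 0 (1⬝2) a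
    have := IsDiagram.of L (1⬝6) (3⬝4) f
    have := IsDiagram.of L (3⬝4) 5 b
    exact diagram_eq L (0⬝6) (5⬝2)
  have h' := T.tr_compViaLoop (a ▷ P ≫ swapBack Y P P ≫ f ▷ P ≫ swapBack Z Q P)
    (swapBack Z P Q ≫ b ▷ P)
  rw [h] at h'
  exact (LoopEq.tr _ _ h').tr_eq.trans (T.tr_compViaLoop _ _)

end PartialTrace

namespace IntObj

variable (T : PartialTrace C)

/-- The morphism whose trace is the composition of two arrows. -/
def compLoop {A B D : IntObj C} (f : A ⟶ B) (g : B ⟶ D) : LoopHom A D B.neg B.neg :=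
  swapBack _ _ _ ≫ mor f ▷ D.neg ≫ swapBack _ _ _ ≫ mor g ▷ A.neg ≫ swapBack _ _ _

theorem pathComp_toPath_cons {A B D : IntObj C} (f : A ⟶ B) (g : B ⟶ D) :
    pathComp T (f.toPath.cons g) = T.tr B.neg (compLoop f g) := by
  refine LoopEq.tr_eq (f := loop (f.toPath.cons g)) ?_
  rw [loop_cons]
  refine (loopEq_postcomp (loopEq_loop_toPath f) g).trans (.of_iso (λ_ _) ?_)
  let L := [A.pos, B.neg, B.pos, A.neg, D.neg, D.pos, B.neg]
  have := IsDiagram.of L (0⬝1) (2⬝3) (mor f)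
  have := IsDiagram.of L (2⬝4) (5⬝6) (mor g)
  exact diagram_eq L ((0⬝4)⬝.unit⬝1) ((5⬝3)⬝6)

/-- The arrow given by a morphism on positive parts and a morphism on negative parts. -/
def ofPosNeg {A B : IntObj C} (h : A.pos ⟶ B.pos) (k : B.neg ⟶ A.neg) : A ⟶ B := ofMor (h ⊗ₘ k)

theorem pathComp_ofPosNeg_cons {A B D : IntObj C} (h : A.pos ⟶ B.pos) (k : B.neg ⟶ A.neg)
    (g : B ⟶ D) :
    pathComp T ((ofPosNeg h k).toPath.cons g) =
      Part.some (ofMor (h ▷ D.neg ≫ mor g ≫ D.pos ◁ k)) := by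
  have := T.tr_compViaLoop (h ▷ D.neg ≫ mor g) (D.pos ◁ k)
  rw [Category.assoc] at this
  rw [pathComp_toPath_cons, ← this]
  congr 1
  let L := [A.pos, B.pos, B.neg, A.neg, D.neg, D.pos, B.neg]
  have := IsDiagram.of L 0 1 h
  have := IsDiagram.of L 2 3 k
  have := IsDiagram.of L (1⬝4) (5⬝6) (mor g)
  exact diagram_eq L ((0⬝4)⬝2) ((5⬝3)⬝6)

theorem pathComp_cons_ofPosNeg {A B D : IntObj C} (f : A ⟶ B) (h : B.pos ⟶ D.pos)
    (k : D.neg ⟶ B.neg) :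
    pathComp T (f.toPath.cons (ofPosNeg h k)) =
      Part.some (ofMor (A.pos ◁ k ≫ mor f ≫ h ▷ A.neg)) := by
  rw [pathComp_toPath_cons, ← T.tr_compViaLoop (A.pos ◁ k) (mor f ≫ h ▷ A.neg)]
  congr 1
  let L := [A.pos, B.neg, B.pos, A.neg, D.neg, D.pos, B.neg]
  have := IsDiagram.of L (0⬝1) (2⬝3) (mor f)
  have := IsDiagram.of L 2 5 h
  have := IsDiagram.of L 4 6 k
  exact diagram_eq L ((0⬝4)⬝1) ((5⬝3)⬝6)

/-- The identity arrow. -/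
def idHom (A : IntObj C) : A ⟶ A := ofMor (𝟙 (A.pos ⊗ A.neg))

theorem tensHom_idHom_symm (X A B : IntObj C) :
    tensHom (idHom X) (symm A B) =
      ofPosNeg (A := tens X (tens A B)) (B := tens X (tens B A)) (X.pos ◁ (β_ A.pos B.pos).hom)
        ((β_ A.neg B.neg).hom ▷ X.neg) := by
  exact diagram_eq [X.pos, X.neg, A.pos, A.neg, B.pos, B.neg] ((0⬝2⬝4)⬝(3⬝5)⬝1) ((0⬝4⬝2)⬝(5⬝3)⬝1)

theorem pathComp_tensHom_symm_left {A A' : IntObj C} (B : IntObj C) (f : A ⟶ A') :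
    pathComp T ((tensHom f (idHom B)).toPath.cons (symm A' B)) =
      pathComp T ((symm A B).toPath.cons (tensHom (idHom B) f)) := by
  refine (pathComp_cons_ofPosNeg T _ _ _).trans (.trans ?_ (pathComp_ofPosNeg_cons T _ _ _).symm)
  congr 1
  let L := [A.pos, A'.neg, A'.pos, A.neg, B.pos, B.neg]
  have := IsDiagram.of L (0⬝1) (2⬝3) (mor f)
  exact diagram_eq L ((0⬝4)⬝1⬝5) ((4⬝2)⬝5⬝3)

theorem pathComp_tensHom_symm_right (A : IntObj C) {B B' : IntObj C} (g : B ⟶ B') :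
    pathComp T ((tensHom (idHom A) g).toPath.cons (symm A B')) =
      pathComp T ((symm A B).toPath.cons (tensHom g (idHom A))) := by
  refine (pathComp_cons_ofPosNeg T _ _ _).trans (.trans ?_ (pathComp_ofPosNeg_cons T _ _ _).symm)
  congr 1
  let L := [B.pos, B'.neg, B'.pos, B.neg, A.pos, A.neg]
  have := IsDiagram.of L (0⬝1) (2⬝3) (mor g)
  exact diagram_eq L ((4⬝0)⬝5⬝1) ((2⬝4)⬝3⬝5)

theorem pathComp_symm_symm (A B : IntObj C) :
    pathComp T ((symm A B).toPath.cons (symm B A)) = Part.some (idHom (tens A B)) := by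
  refine (pathComp_ofPosNeg_cons T _ _ _).trans ?_
  congr 1
  exact diagram_eq [A.pos, A.neg, B.pos, B.neg] ((0⬝2)⬝3⬝1) ((0⬝2)⬝3⬝1)

theorem pathComp_eq_of_compViaTwoLoops {A B D : IntObj C} {f : A ⟶ B} {g : B ⟶ D} {Y Z P Q : C}
    (e : B.neg ≅ P ⊗ Q) (a : A.pos ⊗ D.neg ⟶ Y ⊗ P) (φ : Y ⊗ P ⟶ Z ⊗ Q)
    (b : Z ⊗ Q ⟶ D.pos ⊗ A.neg)
    (h : compLoop f g ≫ _ ◁ e.hom = _ ◁ e.hom ≫ compViaTwoLoops a φ b) :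
    pathComp T (f.toPath.cons g) = Part.some (ofMor (a ≫ φ ≫ b)) := by
  rw [pathComp_toPath_cons, ← T.tr_compViaTwoLoops]
  exact (LoopEq.of_iso e h).tr_eq

/-- Rebracketing of the source of an arrow. -/
def assocSource {P Q R B : IntObj C} (f : tens (tens P Q) R ⟶ B) : tens P (tens Q R) ⟶ B :=
  ofMor (A := tens P (tens Q R)) ((α_ P.pos Q.pos R.pos).inv ▷ B.neg ≫ mor f ≫
    B.pos ◁ (α_ R.neg Q.neg P.neg).inv)

/-- Rebracketing of the target of an arrow. -/
def assocTarget {A P Q R : IntObj C} (f : A ⟶ tens (tens P Q) R) : A ⟶ tens P (tens Q R) :=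
  ofMor (B := tens P (tens Q R)) (A.pos ◁ (α_ R.neg Q.neg P.neg).hom ≫ mor f ≫
    (α_ P.pos Q.pos R.pos).hom ▷ A.neg)

/-- The arrow `A ⟶ B ⊗ D` with source `A ⊗ I` that corresponds to `f : A ⊗ D* ⟶ B` under the
duality. -/
def curryRight {A B D : IntObj C} (f : tens A (dual D) ⟶ B) : tens A one ⟶ tens B D :=
  ofMor (A := tens A one) (B := tens B D)
    (((ρ_ A.pos).hom ▷ _ ≫ (α_ _ _ _).inv ≫ swapBack A.pos D.neg B.neg) ≫
      (swapBack A.pos B.neg D.neg ≫ mor f) ≫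
      (α_ B.pos D.pos A.neg).inv ≫ _ ◁ (λ_ A.neg).inv)

theorem pathComp_unit_right {A B D : IntObj C} (f : tens A (dual D) ⟶ B) :
    pathComp T ((tensHom (idHom A) (unitHom D)).toPath.cons (assocSource (tensHom f (idHom D)))) =
      Part.some (curryRight f) := by
  refine pathComp_eq_of_compViaTwoLoops T (α_ D.neg D.pos A.neg) _ _ _ ?_
  let L := [A.pos, D.neg, B.neg, B.pos, D.pos, A.neg, D.neg, D.pos, A.neg]
  have := IsDiagram.of L ((0⬝6)⬝2) (3⬝4⬝5) (mor f)
  exact diagram_eq L (((0⬝.unit)⬝1⬝2)⬝(6⬝7)⬝8) (((3⬝7)⬝.unit⬝8)⬝1⬝4⬝5)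

/-- The arrow `A ⊗ D* ⟶ B` with target `B ⊗ I` that corresponds to `g : A ⟶ B ⊗ D` under the
duality. -/
def uncurryRight {A B D : IntObj C} (g : A ⟶ tens B D) : tens A (dual D) ⟶ tens B one :=
  ofMor (A := tens A (dual D)) (B := tens B one)
    (((α_ A.pos D.neg _).hom ≫ A.pos ◁ (D.neg ◁ (λ_ B.neg).hom)) ≫
      (mor g ≫ swapBack B.pos D.pos A.neg) ≫
      swapBack B.pos A.neg D.pos ≫ (α_ B.pos D.pos A.neg).hom ≫ (ρ_ B.pos).inv ▷ _)

theorem pathComp_counit_right {A B D : IntObj C} (g : A ⟶ tens B D) :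
    pathComp T ((assocTarget (tensHom g (idHom (dual D)))).toPath.cons
      (tensHom (idHom B) (counitHom D))) = Part.some (uncurryRight g) := by
  refine pathComp_eq_of_compViaTwoLoops T (α_ D.pos D.neg B.neg ≪≫ β_ D.pos (D.neg ⊗ B.neg))
    _ _ _ ?_
  let L := [A.pos, D.neg, B.neg, B.pos, D.pos, A.neg, D.pos, D.neg, B.neg]
  have := IsDiagram.of L (0⬝7⬝8) ((3⬝4)⬝5) (mor g)
  exact diagram_eq L (((0⬝1)⬝.unit⬝2)⬝(6⬝7)⬝8) (((3⬝.unit)⬝6⬝5)⬝(1⬝2)⬝4)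

/-- The arrow `B ⟶ A* ⊗ D` with source `I ⊗ B` that corresponds to `h : A ⊗ B ⟶ D` under the
duality. -/
def curryLeft {A B D : IntObj C} (h : tens A B ⟶ D) : tens one B ⟶ tens (dual A) D :=
  ofMor (A := tens one B) (B := tens (dual A) D)
    (((λ_ B.pos).hom ▷ _ ≫ (α_ B.pos D.neg A.pos).inv) ≫
      ((β_ (B.pos ⊗ D.neg) A.pos).hom ≫ (α_ _ _ _).inv ≫ mor h) ≫
      (α_ D.pos B.neg A.neg).inv ≫ (β_ _ _).hom ≫ (α_ _ _ _).inv ≫ _ ◁ (ρ_ B.neg).inv)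

theorem pathComp_unit_left {A B D : IntObj C} (h : tens A B ⟶ D) :
    pathComp T ((assocTarget (tensHom (unitHom A) (idHom B))).toPath.cons
      (tensHom (idHom (dual A)) h)) = Part.some (curryLeft h) := by
  refine pathComp_eq_of_compViaTwoLoops T (β_ (B.neg ⊗ A.neg) A.pos) _ _ _ ?_
  let L := [A.pos, B.pos, D.neg, D.pos, B.neg, A.neg, B.neg, A.neg, A.pos]
  have := IsDiagram.of L ((8⬝1)⬝2) (3⬝4⬝5) (mor h)
  exact diagram_eq L (((.unit⬝1)⬝2⬝0)⬝(6⬝7)⬝8) (((7⬝3)⬝6⬝.unit)⬝0⬝4⬝5)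

/-- The arrow `A ⊗ B ⟶ D` with target `I ⊗ D` that corresponds to `k : B ⟶ A* ⊗ D` under the
duality. -/
def uncurryLeft {A B D : IntObj C} (k : B ⟶ tens (dual A) D) : tens A B ⟶ tens one D :=
  ofMor (A := tens A B) (B := tens one D)
    ((_ ◁ (ρ_ D.neg).hom ≫ (β_ A.pos B.pos).hom ▷ _ ≫ (α_ _ _ _).hom ≫
        B.pos ◁ (β_ A.pos D.neg).hom) ≫
      (mor k ≫ (α_ A.neg D.pos B.neg).hom ≫ (β_ A.neg (D.pos ⊗ B.neg)).hom) ≫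
      (α_ _ _ _).hom ≫ (λ_ D.pos).inv ▷ _)

theorem pathComp_counit_left {A B D : IntObj C} (k : B ⟶ tens (dual A) D) :
    pathComp T ((tensHom (idHom A) k).toPath.cons
      (assocSource (tensHom (counitHom A) (idHom D)))) = Part.some (uncurryLeft k) := by
  refine pathComp_eq_of_compViaTwoLoops T (Iso.refl ((D.neg ⊗ A.pos) ⊗ A.neg)) _ _ _ ?_
  let L := [A.pos, B.pos, D.neg, A.neg, D.pos, B.neg, D.neg, A.pos, A.neg]
  have := IsDiagram.of L (1⬝6⬝7) ((3⬝4)⬝5) (mor k)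
  exact diagram_eq L (((0⬝1)⬝2⬝.unit)⬝(6⬝7)⬝8) (((.unit⬝4)⬝5⬝8)⬝(2⬝0)⬝3)

end IntObj

end Totality

/-! ### The compact closed structure in the strict case -/

section CompactClosed

namespace IsStrictMonoidal

variable {D : Type u} [Category.{v} D] [MonoidalCategory D] [IsStrictMonoidal D]

theorem associator_hom_eq (X Y Z : D) : (α_ X Y Z).hom = eqToHom (tensor_assoc X Y Z) := by
  rw [associator_eq, eqToIso.hom]

theorem associator_inv_eq (X Y Z : D) : (α_ X Y Z).inv = eqToHom (tensor_assoc X Y Z).symm := by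
  rw [associator_eq, eqToIso.inv]

theorem leftUnitor_hom_eq (X : D) : (λ_ X).hom = eqToHom (unit_tensor X) := by
  rw [leftUnitor_eq, eqToIso.hom]

theorem leftUnitor_inv_eq (X : D) : (λ_ X).inv = eqToHom (unit_tensor X).symm := by
  rw [leftUnitor_eq, eqToIso.inv]

theorem rightUnitor_hom_eq (X : D) : (ρ_ X).hom = eqToHom (tensor_unit X) := by
  rw [rightUnitor_eq, eqToIso.hom]

theorem rightUnitor_inv_eq (X : D) : (ρ_ X).inv = eqToHom (tensor_unit X).symm := by
  rw [rightUnitor_eq, eqToIso.inv]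

end IsStrictMonoidal

open IsStrictMonoidal

namespace IntObj

section StrictMonoidal

variable {D : Type u} [Category.{v} D] [MonoidalCategory D]

theorem cast_eq_ofMor {A A' B B' : IntObj D} (hA : A = A') (hB : B = B') (f : A ⟶ B)
    {a : A'.pos ⟶ A.pos} {b : B'.neg ⟶ B.neg} {c : B.pos ⟶ B'.pos} {d : A.neg ⟶ A'.neg}
    (ha : a = eqToHom (congrArg pos hA.symm)) (hb : b = eqToHom (congrArg neg hB.symm))
    (hc : c = eqToHom (congrArg pos hB)) (hd : d = eqToHom (congrArg neg hA)) :
    f.cast hA hB = ofMor ((a ⊗ₘ b) ≫ mor f ≫ (c ⊗ₘ d)) := by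
  subst hA hB ha hb hc hd
  simp

variable [IsStrictMonoidal D]

theorem tens_assoc (P Q R : IntObj D) : tens (tens P Q) R = tens P (tens Q R) :=
  IntObj.ext (tensor_assoc _ _ _) (tensor_assoc _ _ _).symm

theorem tens_one (A : IntObj D) : tens A one = A :=
  IntObj.ext (tensor_unit _) (unit_tensor _)

theorem one_tens (A : IntObj D) : tens one A = A :=
  IntObj.ext (unit_tensor _) (tensor_unit _)

theorem cast_tens_assoc {P Q R P' Q' R' : IntObj D}
    (f : tens (tens P Q) R ⟶ tens (tens P' Q') R') :
    f.cast (tens_assoc P Q R) (tens_assoc P' Q' R') =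
      ofMor (A := tens P (tens Q R)) (B := tens P' (tens Q' R'))
        (((α_ P.pos Q.pos R.pos).inv ⊗ₘ (α_ R'.neg Q'.neg P'.neg).hom) ≫ mor f ≫
          ((α_ P'.pos Q'.pos R'.pos).hom ⊗ₘ (α_ R.neg Q.neg P.neg).inv)) :=
  cast_eq_ofMor _ _ f (associator_inv_eq _ _ _) (associator_hom_eq _ _ _)
    (associator_hom_eq _ _ _) (associator_inv_eq _ _ _)

end StrictMonoidal

theorem pathComp_cast (T : PartialTrace C) {A A' B D D' : IntObj C} (hA : A = A') (hD : D = D')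
    {f : A ⟶ B} {g : B ⟶ D} {h : A ⟶ D} (hh : pathComp T (f.toPath.cons g) = Part.some h) :
    pathComp T ((f.cast hA rfl).toPath.cons (g.cast rfl hD)) = Part.some (h.cast hA hD) := by
  subst hA hD
  exact hh

variable [IsStrictMonoidal C]

theorem cast_eq_assocSource {P Q R B : IntObj C} (f : tens (tens P Q) R ⟶ B) :
    f.cast (tens_assoc P Q R) rfl = assocSource f := by
  rw [cast_eq_ofMor _ rfl f (associator_inv_eq _ _ _) (b := 𝟙 _) (c := 𝟙 _) rfl rfl
    (associator_inv_eq _ _ _)]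
  let L := [P.pos, Q.pos, R.pos, B.neg, B.pos, R.neg, Q.neg, P.neg]
  have := IsDiagram.of L (((0⬝1)⬝2)⬝3) (4⬝5⬝6⬝7) (mor f)
  exact diagram_eq L ((0⬝1⬝2)⬝3) (4⬝(5⬝6)⬝7)

theorem cast_eq_assocTarget {A P Q R : IntObj C} (f : A ⟶ tens (tens P Q) R) :
    f.cast rfl (tens_assoc P Q R) = assocTarget f := by
  rw [cast_eq_ofMor rfl _ f (a := 𝟙 _) (d := 𝟙 _) rfl (associator_hom_eq _ _ _)
    (associator_hom_eq _ _ _) rfl]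
  let L := [P.pos, Q.pos, R.pos, A.neg, A.pos, R.neg, Q.neg, P.neg]
  have := IsDiagram.of L (4⬝5⬝6⬝7) (((0⬝1)⬝2)⬝3) (mor f)
  exact diagram_eq L (4⬝(5⬝6)⬝7) ((0⬝1⬝2)⬝3)

theorem tensHom_assoc {A B D A' B' D' : IntObj C} (f : A ⟶ A') (g : B ⟶ B') (h : D ⟶ D') :
    (tensHom (tensHom f g) h).cast (tens_assoc A B D) (tens_assoc A' B' D') =
      tensHom f (tensHom g h) := by
  rw [cast_tens_assoc]
  let L := [A.pos, A'.neg, A'.pos, A.neg, B.pos, B'.neg, B'.pos, B.neg, D.pos, D'.neg, D'.pos,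
    D.neg]
  have := IsDiagram.of L (0⬝1) (2⬝3) (mor f)
  have := IsDiagram.of L (4⬝5) (6⬝7) (mor g)
  have := IsDiagram.of L (8⬝9) (10⬝11) (mor h)
  exact diagram_eq L ((0⬝4⬝8)⬝(9⬝5)⬝1) ((2⬝6⬝10)⬝(11⬝7)⬝3)

theorem tensHom_one {A B : IntObj C} (f : A ⟶ B) :
    (tensHom f (idHom one)).cast (tens_one A) (tens_one B) = f := by
  rw [cast_eq_ofMor _ _ _ (rightUnitor_inv_eq _) (leftUnitor_inv_eq _) (rightUnitor_hom_eq _)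
    (leftUnitor_hom_eq _)]
  let L := [A.pos, B.neg, B.pos, A.neg]
  have := IsDiagram.of L (0⬝1) (2⬝3) (mor f)
  exact diagram_eq L (0⬝1) (2⬝3)

theorem one_tensHom {A B : IntObj C} (f : A ⟶ B) :
    (tensHom (idHom one) f).cast (one_tens A) (one_tens B) = f := by
  rw [cast_eq_ofMor _ _ _ (leftUnitor_inv_eq _) (rightUnitor_inv_eq _) (leftUnitor_hom_eq _)
    (rightUnitor_hom_eq _)]
  let L := [A.pos, B.neg, B.pos, A.neg]
  have := IsDiagram.of L (0⬝1) (2⬝3) (mor f)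
  exact diagram_eq L (0⬝1) (2⬝3)

theorem cast_tensHom_symm_idHom (A B D : IntObj C) :
    (tensHom (symm A B) (idHom D)).cast (tens_assoc A B D) (tens_assoc B A D) =
      ofPosNeg (A := tens A (tens B D)) (B := tens B (tens A D))
        ((α_ _ _ _).inv ≫ (β_ A.pos B.pos).hom ▷ D.pos ≫ (α_ _ _ _).hom)
        ((α_ _ _ _).hom ≫ D.neg ◁ (β_ A.neg B.neg).hom ≫ (α_ _ _ _).inv) := by
  rw [cast_tens_assoc]
  exact diagram_eq [A.pos, A.neg, B.pos, B.neg, D.pos, D.neg] ((0⬝2⬝4)⬝(5⬝1)⬝3)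
    ((2⬝0⬝4)⬝(5⬝3)⬝1)

variable (T : PartialTrace C)

theorem pathComp_symm_hexagon (A B D : IntObj C) :
    pathComp T (((tensHom (symm A B) (idHom D)).cast (tens_assoc A B D)
      (tens_assoc B A D)).toPath.cons
      ((tensHom (idHom B) (symm A D)).cast rfl (tens_assoc B D A).symm)) =
    Part.some (symm A (tens B D)) := by
  rw [cast_tensHom_symm_idHom, pathComp_ofPosNeg_cons,
    cast_eq_ofMor rfl _ (tensHom (idHom B) (symm A D)) (a := 𝟙 _) (d := 𝟙 _) rfl
      (associator_inv_eq _ _ _) (associator_inv_eq _ _ _) rfl]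
  congr 1
  exact diagram_eq [A.pos, A.neg, B.pos, B.neg, D.pos, D.neg] ((0⬝2⬝4)⬝1⬝5⬝3)
    (((2⬝4)⬝0)⬝(5⬝3)⬝1)

theorem pathComp_snake (A : IntObj C) :
    pathComp T (((tensHom (idHom A) (unitHom A)).cast (tens_one A) rfl).toPath.cons
      ((tensHom (counitHom A) (idHom A)).cast (tens_assoc A (dual A) A) (one_tens A))) =
    Part.some (idHom A) := by
  have h := pathComp_cast T (tens_one A) (one_tens A) (pathComp_unit_right T (counitHom A))
  rw [← cast_eq_assocSource, Quiver.Hom.cast_cast] at h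
  refine h.trans (congrArg Part.some ?_)
  rw [cast_eq_ofMor _ _ _ (rightUnitor_inv_eq _) (rightUnitor_inv_eq _) (leftUnitor_hom_eq _)
    (leftUnitor_hom_eq _)]
  exact diagram_eq [A.pos, A.neg] (0⬝1) (0⬝1)

theorem pathComp_snake_dual (A : IntObj C) :
    pathComp T (((tensHom (unitHom A) (idHom (dual A))).cast (one_tens (dual A))
      (tens_assoc (dual A) A (dual A))).toPath.cons
      ((tensHom (idHom (dual A)) (counitHom A)).cast rfl (tens_one (dual A)))) =
    Part.some (idHom (dual A)) := by
  have h := pathComp_cast T (one_tens (dual A)) (tens_one (dual A))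
    (pathComp_unit_left T (counitHom A))
  rw [← cast_eq_assocTarget, Quiver.Hom.cast_cast] at h
  refine h.trans (congrArg Part.some ?_)
  rw [cast_eq_ofMor _ _ _ (leftUnitor_inv_eq _) (leftUnitor_inv_eq _) (rightUnitor_hom_eq _)
    (rightUnitor_hom_eq _)]
  exact diagram_eq [A.pos, A.neg] (1⬝0) (1⬝0)

end IntObj

open IntObj

theorem intPara_one {C : Type u} [Category.{v} C] [MonoidalCategory C] [SymmetricCategory C]
    {T : PartialTrace C} (h : (intPara T).IsParacategory) (A : IntObj C) : h.one A = idHom A :=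
  Part.get_eq_of_mem (Part.eq_some_iff.1 (pathComp_nil T A)) _

variable [IsStrictMonoidal C] (T : PartialTrace C)

theorem intSymMon_isStrictSymmetricMonoidal : (intSymMon T).IsStrictSymmetricMonoidal where
  toIsParacategory := intPara_isParacategory T
  tensor_isFunctor := intSymMon_tensor_isFunctor T
  assoc_obj := tens_assoc
  assoc_hom := tensHom_assoc
  tensor_unit_obj := tens_one
  unit_tensor_obj := one_tens
  tensor_unit_hom f := by
    rw [intPara_one]
    exact tensHom_one f
  unit_tensor_hom f := by
    rw [intPara_one]
    exact one_tensHom f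
  sym_total_left {X A B Y} f := by
    rw [intPara_one]
    change (pathComp T ((tensHom (idHom X) (symm A B)).toPath.cons f)).Dom
    rw [tensHom_idHom_symm]
    exact (congrArg Part.Dom (pathComp_ofPosNeg_cons T _ _ f)).mpr trivial
  sym_total_right {X A B Y} g := by
    rw [intPara_one]
    change (pathComp T (g.toPath.cons (tensHom (idHom X) (symm A B)))).Dom
    rw [tensHom_idHom_symm]
    exact (congrArg Part.Dom (pathComp_cons_ofPosNeg T g _ _)).mpr trivial
  sym_natural_left B f := by
    rw [intPara_one]
    exact pathComp_tensHom_symm_left T B f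
  sym_natural_right A _ _ g := by
    rw [intPara_one]
    exact pathComp_tensHom_symm_right T A g
  sym_sym A B := by
    rw [intPara_one]
    exact pathComp_symm_symm T A B
  hexagon A B D := by
    rw [intPara_one, intPara_one]
    exact pathComp_symm_hexagon T A B D

theorem intP_isCompactClosed : (intP T).IsCompactClosed where
  toIsStrictSymmetricMonoidal := intSymMon_isStrictSymmetricMonoidal T
  total_unit_right {A B D} f := by
    rw [intPara_one, intPara_one]
    change (pathComp T ((tensHom (idHom A) (unitHom D)).toPath.cons
      ((tensHom f (idHom D)).cast (tens_assoc A (dual D) D) rfl))).Dom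
    rw [cast_eq_assocSource, pathComp_unit_right]
    trivial
  total_counit_right {A B D} g := by
    rw [intPara_one, intPara_one]
    change (pathComp T (((tensHom g (idHom (dual D))).cast rfl
      (tens_assoc B D (dual D))).toPath.cons (tensHom (idHom B) (counitHom D)))).Dom
    rw [cast_eq_assocTarget, pathComp_counit_right]
    trivial
  total_unit_left {A B D} h := by
    rw [intPara_one, intPara_one]
    change (pathComp T (((tensHom (unitHom A) (idHom B)).cast rfl
      (tens_assoc (dual A) A B)).toPath.cons (tensHom (idHom (dual A)) h))).Dom
    rw [cast_eq_assocTarget, pathComp_unit_left]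
    trivial
  total_counit_left {A B D} k := by
    rw [intPara_one, intPara_one]
    change (pathComp T ((tensHom (idHom A) k).toPath.cons
      ((tensHom (counitHom A) (idHom D)).cast (tens_assoc A (dual A) D) rfl))).Dom
    rw [cast_eq_assocSource, pathComp_counit_left]
    trivial
  snake A := by
    rw [intPara_one]
    exact pathComp_snake T A
  snake_dual A := by
    rw [intPara_one]
    exact pathComp_snake_dual T A

end CompactClosed

/-! ### The embedding of the traced category -/

section Embedding

section Hom

variable {D : Type u} [Category.{v} D] [MonoidalCategory D]

theorem IntObj.nHom_injective {A B : D} :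
    Function.Injective (nHom : (A ⟶ B) → (nObj A ⟶ nObj B)) := by
  intro f g h
  have h' : (ρ_ A).hom ≫ f ≫ (ρ_ B).inv = (ρ_ A).hom ≫ g ≫ (ρ_ B).inv := h
  simpa using h'

theorem IntObj.nHom_surjective {A B : D} :
    Function.Surjective (nHom : (A ⟶ B) → (nObj A ⟶ nObj B)) := by
  intro (g : A ⊗ 𝟙_ D ⟶ B ⊗ 𝟙_ D)
  refine ⟨(ρ_ A).inv ≫ g ≫ (ρ_ B).hom, ?_⟩
  change (ρ_ A).hom ≫ ((ρ_ A).inv ≫ g ≫ (ρ_ B).hom) ≫ (ρ_ B).inv = g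
  simp

theorem IntObj.tens_nObj [IsStrictMonoidal D] (A B : D) :
    tens (nObj A) (nObj B) = nObj (A ⊗ B) :=
  IntObj.ext rfl (IsStrictMonoidal.unit_tensor (𝟙_ D))

end Hom

namespace IntObj

theorem nHom_eq_ofPosNeg {A B : C} (f : A ⟶ B) :
    nHom f = ofPosNeg (A := nObj A) (B := nObj B) f (𝟙 (𝟙_ C)) := by
  let L := [A, B]
  have := IsDiagram.of L 0 1 f
  exact diagram_eq L (0⬝.unit) (1⬝.unit)

theorem pathComp_nHom_nHom (T : PartialTrace C) {A B D : C} (f : A ⟶ B) (g : B ⟶ D) :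
    pathComp T ((nHom f).toPath.cons (nHom g)) = Part.some (nHom (f ≫ g)) := by
  rw [nHom_eq_ofPosNeg f]
  refine (pathComp_ofPosNeg_cons T (A := nObj A) (B := nObj B) f (𝟙 _) (nHom g)).trans
    (congrArg Part.some ?_)
  let L := [A, B, D]
  have := IsDiagram.of L 0 1 f
  have := IsDiagram.of L 1 2 g
  exact diagram_eq L (0⬝.unit) (2⬝.unit)

end IntObj

open IntObj

theorem intN_isFunctor (T : PartialTrace C) :
    ParaData.IsFunctor (P := paraOfCategory C) (Q := intPara T) (intN T) := by
  intro A B p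
  refine le_of_eq ?_
  rw [Part.map_some]
  symm
  induction p with
  | nil =>
    refine (pathComp_nil T (nObj A)).trans (congrArg Part.some ?_)
    change 𝟙 (A ⊗ 𝟙_ C) = (ρ_ A).hom ≫ 𝟙 A ≫ (ρ_ A).inv
    simp
  | cons p e ih =>
    have h := pathComp_comp_toPath_comp .nil ih (nHom e).toPath
    rw [Quiver.Path.nil_comp ((intN T).mapPath p)] at h
    exact h.symm.trans (pathComp_nHom_nHom T (composePath p) e)

section Category

variable {D : Type u} [Category.{v} D]

theorem cast_eq_eqToHom {X Y X' Y' : D} (hX : X = X') (hY : Y = Y') (f : X ⟶ Y) :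
    f.cast hX hY = eqToHom hX.symm ≫ f ≫ eqToHom hY := by
  subst hX hY
  simp

theorem paraOfCategory_isParacategory (D : Type u) [Category.{v} D] :
    (paraOfCategory D).IsParacategory where
  comp_nil_dom _ := trivial
  comp_toPath f := congrArg Part.some (composePath_toPath f)
  comp_comp r f s h := by
    refine congrArg Part.some ?_
    rw [composePath_comp, composePath_comp, composePath_comp, composePath_comp, composePath_toPath]
    rfl

theorem paraOfCategory_comp₂ {X Y Z : D} (f : X ⟶ Y) (g : Y ⟶ Z) :
    (paraOfCategory D).comp₂ f g = Part.some (f ≫ g) :=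
  congrArg Part.some (congrArg (· ≫ g) (composePath_toPath f))

theorem paraOfCategory_comp₂_congr {X Y Y' Z : D} {f : X ⟶ Y} {g : Y ⟶ Z} {f' : X ⟶ Y'}
    {g' : Y' ⟶ Z} (h : f ≫ g = f' ≫ g') :
    (paraOfCategory D).comp₂ f g = (paraOfCategory D).comp₂ f' g' := by
  rw [paraOfCategory_comp₂, paraOfCategory_comp₂, h]

theorem paraOfCategory_prod_comp {X Y : ((paraOfCategory D).prod (paraOfCategory D)).Obj}
    (p : Quiver.Path X Y) :
    ((paraOfCategory D).prod (paraOfCategory D)).comp p =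
      Part.some (composePath (((paraOfCategory D).fst (paraOfCategory D)).mapPath p),
        composePath (((paraOfCategory D).snd (paraOfCategory D)).mapPath p)) :=
  (Part.bind_some _ fun f => (Part.some _).map fun g => (f, g)).trans (Part.map_some _ _)

end Category

variable (C) in
theorem symMonParaOfCategory_tensor_isFunctor :
    ParaData.IsFunctor (P := (paraOfCategory C).prod (paraOfCategory C)) (Q := paraOfCategory C)
      (symMonParaOfCategory C).tensor := by
  intro X Y p
  refine le_of_eq ?_
  refine (congrArg (Part.map _) (paraOfCategory_prod_comp p)).trans
    ((Part.map_some _ _).trans (congrArg Part.some ?_))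
  induction p with
  | nil => exact id_tensorHom_id X.1 X.2
  | cons p e ih =>
    exact (tensorHom_comp_tensorHom _ _ _ _).symm.trans (congrArg (· ≫ _) ih)

variable [IsStrictMonoidal C]

open IsStrictMonoidal

variable (C) in
theorem symMonParaOfCategory_isStrictSymmetricMonoidal :
    (symMonParaOfCategory C).IsStrictSymmetricMonoidal where
  toIsParacategory := paraOfCategory_isParacategory C
  tensor_isFunctor := symMonParaOfCategory_tensor_isFunctor C
  assoc_obj := tensor_assoc
  assoc_hom f g h := by
    refine (cast_eq_eqToHom (D := C) _ _ _).trans ?_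
    rw [← associator_inv_eq, ← associator_hom_eq]
    exact (Iso.inv_comp_eq _).2 (associator_naturality f g h)
  tensor_unit_obj := tensor_unit
  unit_tensor_obj := unit_tensor
  tensor_unit_hom f := by
    refine (cast_eq_eqToHom (D := C) _ _ _).trans ?_
    rw [← rightUnitor_inv_eq, ← rightUnitor_hom_eq]
    refine (Iso.inv_comp_eq _).2 ?_
    exact (congrArg (· ≫ _) (tensorHom_id _ _)).trans (rightUnitor_naturality f)
  unit_tensor_hom f := by
    refine (cast_eq_eqToHom (D := C) _ _ _).trans ?_
    rw [← leftUnitor_inv_eq, ← leftUnitor_hom_eq]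
    refine (Iso.inv_comp_eq _).2 ?_
    exact (congrArg (· ≫ _) (id_tensorHom _ _)).trans (leftUnitor_naturality f)
  sym_total_left _ := trivial
  sym_total_right _ := trivial
  sym_natural_left B f :=
    paraOfCategory_comp₂_congr (D := C) (BraidedCategory.braiding_naturality f (𝟙 B))
  sym_natural_right A _ _ g :=
    paraOfCategory_comp₂_congr (D := C) (BraidedCategory.braiding_naturality (𝟙 A) g)
  sym_sym A B :=
    (paraOfCategory_comp₂ (D := C) _ _).trans
      (congrArg Part.some (SymmetricCategory.symmetry (C := C) A B))
  hexagon (A B D : C) := by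
    refine (paraOfCategory_comp₂ (D := C) _ _).trans (congrArg Part.some ?_)
    rw [cast_eq_eqToHom (D := C), cast_eq_eqToHom (D := C), ← associator_inv_eq,
      ← associator_hom_eq, ← associator_inv_eq]
    exact diagram_eq [A, B, D] (0⬝1⬝2) ((1⬝2)⬝0)

namespace IntObj

theorem tensHom_nHom {A B A' B' : C} (f : A ⟶ B) (g : A' ⟶ B') :
    (tensHom (nHom f) (nHom g)).cast (tens_nObj A A') (tens_nObj B B') = nHom (f ⊗ₘ g) := by
  rw [cast_eq_ofMor (tens_nObj A A') (tens_nObj B B') _ (a := 𝟙 _) (c := 𝟙 _) rfl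
    (leftUnitor_inv_eq _) rfl (leftUnitor_hom_eq _)]
  let L := [A, B, A', B']
  have := IsDiagram.of L 0 1 f
  have := IsDiagram.of L 2 3 g
  exact diagram_eq L ((0⬝2)⬝.unit) ((1⬝3)⬝.unit)

theorem symm_nObj (A B : C) :
    (symm (nObj A) (nObj B)).cast (tens_nObj A B) (tens_nObj B A) = nHom (β_ A B).hom := by
  rw [cast_eq_ofMor (tens_nObj A B) (tens_nObj B A) _ (a := 𝟙 _) (c := 𝟙 _) rfl
    (leftUnitor_inv_eq _) rfl (leftUnitor_hom_eq _)]
  exact diagram_eq [A, B] ((0⬝1)⬝.unit) ((1⬝0)⬝.unit)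

end IntObj

theorem intN_isStrictSymmetricMonoidalFunctor (T : PartialTrace C) :
    SymMonParaData.IsStrictSymmetricMonoidalFunctor
      (P := symMonParaOfCategory C) (Q := (intP T).toSymMonParaData) (intN T) where
  isFunctor := intN_isFunctor T
  tensor_obj := tens_nObj
  unit_obj := rfl
  tensor_hom := tensHom_nHom
  sym_hom := symm_nObj

end Embedding

end IntConstruction

theorem mainTheorem4 {C : Type u} [Category.{v} C] [MonoidalCategory C] [SymmetricCategory C]
    [IsStrictMonoidal C] (T : PartialTrace C) :
    (intP T).IsCompactClosed ∧
    (symMonParaOfCategory C).IsStrictSymmetricMonoidal ∧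
    SymMonParaData.IsStrictSymmetricMonoidalFunctor
      (P := symMonParaOfCategory C) (Q := (intP T).toSymMonParaData) (intN T) ∧
    (∀ A B : (symMonParaOfCategory C).Obj,
      Function.Surjective ((intN T).map : (A ⟶ B) → ((intN T).obj A ⟶ (intN T).obj B))) ∧
    (∀ A B : (symMonParaOfCategory C).Obj,
      Function.Injective ((intN T).map : (A ⟶ B) → ((intN T).obj A ⟶ (intN T).obj B))) ∧
    ∃ (D : CompactClosedParaData.{v, u}) (F : (symMonParaOfCategory C).Obj ⥤q D.Obj),
      D.IsCompactClosed ∧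
      SymMonParaData.IsStrictSymmetricMonoidalFunctor
        (P := symMonParaOfCategory C) (Q := D.toSymMonParaData) F ∧
      (∀ A B : (symMonParaOfCategory C).Obj,
        Function.Surjective (F.map : (A ⟶ B) → (F.obj A ⟶ F.obj B))) ∧
      (∀ A B : (symMonParaOfCategory C).Obj,
        Function.Injective (F.map : (A ⟶ B) → (F.obj A ⟶ F.obj B))) := by
  have hF : ∀ A B : C, Function.Surjective ((intN T).map : (A ⟶ B) → _) :=
    fun _ _ g => IntObj.nHom_surjective g
  have hI : ∀ A B : C, Function.Injective ((intN T).map : (A ⟶ B) → _) :=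
    fun _ _ _ _ h => IntObj.nHom_injective h
  exact ⟨intP_isCompactClosed T, symMonParaOfCategory_isStrictSymmetricMonoidal C,
    intN_isStrictSymmetricMonoidalFunctor T, hF, hI, intP T, intN T, intP_isCompactClosed T,
    intN_isStrictSymmetricMonoidalFunctor T, hF, hI⟩
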